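/- Let $\mathcal H$ be a separable complex Hilbert space and $\mathcal L=\mathcal L(\mathcal H)$ the bounded linear operators on $\mathcal H$. For a Banach space $\mathcal Y$, let $\hat f(n)$ denote the $n$th Taylor coefficient at $0$ of an analytic function $f:\mathbb D\to\mathcal Y$ on the open unit disc, and put $Df(z)=zf'(z)+f(z)$. Let $\|f\|_{H^2(\mathcal H)}^2=\sup_{0<r<1}\int_{\mathbb T}\|f(r\zeta)\|_{\mathcal H}^2\,dm(\zeta)$, with $m$ normalized Lebesgue measure on the unit circle $\mathbb T$, and let $\mathcal O_1(\mathcal H)$ be the set of $\mathcal H$-valued functions $f$ that are analytic on some disc $\{|z|<R\}$, $R>1$, and satisfy $\|f\|_{H^2(\mathcal H)}=1$. For analytic $\phi:\mathbb D\to\mathcal L$ put $\phi^\#(z)=\phi(\bar z)^*$ and $$\Gamma_\phi f(z)=\sum_{n=0}^\infty\Big(\sum_{m=0}^\infty\hat\phi(m+n)\hat f(m)\Big)z^n,\qquad f\in\mathcal O_1(\mathcal H),\ z\in\mathbb D,$$ $$\|\Gamma_\phi\|=\sup_{f\in\mathcal O_1(\mathcal H)}\|\Gamma_\phi f\|_{H^2(\mathcal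 H)},\qquad \|\phi\|_{\mathrm{BMOA}_{\mathcal C}}^2=\sup_{f\in\mathcal O_1(\mathcal H)}\int_{\mathbb D}\big\|(D\phi)(z)f(\bar z)\big\|_{\mathcal H}^2\,(1-|z|^2)\,dA(z),$$ where $dA$ is area measure (suprema over the empty set are $0$). Let $\mathrm{BMOA}_{\mathcal{NP}}$, $\mathrm{BMOA}_{\mathcal C}$ and $\mathrm{BMOA}_{\mathcal C^\#}$ be the sets of analytic $\phi:\mathbb D\to\mathcal L$ for which, respectively, $\|\Gamma_\phi\|<\infty$, $\|\phi\|_{\mathrm{BMOA}_{\mathcal C}}<\infty$ and $\|\phi^\#\|_{\mathrm{BMOA}_{\mathcal C}}<\infty$. Then there is an absolute constant $C>0$ (independent of $\mathcal H$ and $\phi$) such that the following holds. If $\phi:\mathbb D\to\mathcal L$ is analytic, $\|\phi\|_{\mathrm{BMOA}_{\mathcal C}}<\infty$ and $\|\phi^\#\|_{\mathrm{BMOA}_{\mathcal C}}<\infty$, then $\|\Gamma_\phi\|<\infty$, and moreover $$\|\Gamma_\phi\|\le C\big(\|\phi\|_{\mathrm{BMOA}_{\mathcal C}}+\|\phi^\#\|_{\mathrm{BMOA}_{\mathcal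 C}}\big).$$ If $\mathcal H$ is infinite-dimensional, then the converse fails: there is an analytic $\phi:\mathbb D\to\mathcal L$ with $\|\Gamma_\phi\|<\infty$ for which $\|\phi\|_{\mathrm{BMOA}_{\mathcal C}}$ and $\|\phi^\#\|_{\mathrm{BMOA}_{\mathcal C}}$ are not both finite. In other words, $\mathrm{BMOA}_{\mathcal C}\cap\mathrm{BMOA}_{\mathcal C^\#}\subsetneq\mathrm{BMOA}_{\mathcal{NP}}$. -/

import Mathlib

open scoped ENNReal NNReal

noncomputable section

namespace VectorHankel

/-- The open unit disc. -/
def disc : Set ℂ := Metric.ball (0 : ℂ) 1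

/-- `f ∈ Hol(Y)`: `f` is analytic on the open unit disc. Functions on the disc are represented by
functions on `ℂ`; every notion below only looks at their values on the disc. -/
def IsHol {Y : Type*} [NormedAddCommGroup Y] [NormedSpace ℂ Y] (f : ℂ → Y) : Prop :=
  DifferentiableOn ℂ f disc

/-- `f ∈ 𝒪(Y)`: `f` is analytic on a disc centred at the origin of radius larger than one. -/
def IsHolLarger {Y : Type*} [NormedAddCommGroup Y] [NormedSpace ℂ Y] (f : ℂ → Y) : Prop :=
  ∃ R : ℝ, 1 < R ∧ DifferentiableOn ℂ f (Metric.ball (0 : ℂ) R)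

/-- The `n`-th Taylor coefficient of `f` at the origin. -/
def taylorCoeff {Y : Type*} [NormedAddCommGroup Y] [NormedSpace ℂ Y] (f : ℂ → Y) (n : ℕ) : Y :=
  ((n.factorial : ℂ)⁻¹) • iteratedDeriv n f 0

/-- The Hardy norm `‖f‖_{H^p} = sup_{0 < r < 1} ‖f_r‖_{L^p(𝕋)}`, where `f_r(ζ) = f(rζ)` and the
circle carries normalized Lebesgue measure; it is `∞` when `f` is not in `H^p`. -/
def hardyNorm {Y : Type*} [NormedAddCommGroup Y] (p : ℝ≥0∞) (f : ℂ → Y) : ℝ≥0∞ :=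
  ⨆ r ∈ Set.Ioo (0 : ℝ) 1,
    MeasureTheory.eLpNorm
      (fun t : AddCircle (1 : ℝ) => f ((r : ℂ) * (AddCircle.toCircle t : ℂ)))
      p AddCircle.haarAddCircle

/-- `𝒪₁(Y)`: the functions in `𝒪(Y)` with `H²`-norm one. -/
def unitHolLarger (Y : Type*) [NormedAddCommGroup Y] [NormedSpace ℂ Y] : Set (ℂ → Y) :=
  {f | IsHolLarger f ∧ hardyNorm 2 f = 1}

/-- The differentiation operator `D f (z) = z f'(z) + f(z)`. -/
def diffOp {Y : Type*} [NormedAddCommGroup Y] [NormedSpace ℂ Y] (f : ℂ → Y) : ℂ → Y :=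
  fun z => z • deriv f z + f z

section Operators

variable {H : Type*} [NormedAddCommGroup H] [InnerProductSpace ℂ H]

/-- The Hankel operator `Γ_φ f (z) = ∑ₙ (∑ₘ φ̂(m + n) f̂(m)) zⁿ`. Both series converge absolutely
for `φ` analytic on the disc, `f ∈ 𝒪(H)` and `|z| < 1`. -/
def hankel (φ : ℂ → (H →L[ℂ] H)) (f : ℂ → H) : ℂ → H :=
  fun z => ∑' n : ℕ, z ^ n • ∑' m : ℕ, (taylorCoeff φ (m + n)) (taylorCoeff f m)

/-- `‖φ‖_{BMOA_NP}`, the norm of `Γ_φ` on `H²(H)`: `sup_{f ∈ 𝒪₁(H)} ‖Γ_φ f‖_{H²(H)}`. -/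
def normNP (φ : ℂ → (H →L[ℂ] H)) : ℝ≥0∞ :=
  ⨆ f ∈ unitHolLarger H, hardyNorm 2 (hankel φ f)

/-- `‖φ‖_{BMOA_C}`, the square root of the supremum over `f ∈ 𝒪₁(H)` of
`∫_𝔻 ‖(Dφ)(z) f(z̄)‖² (1 - |z|²) dA(z)`, where `dA` is area measure. -/
def normC (φ : ℂ → (H →L[ℂ] H)) : ℝ≥0∞ :=
  (⨆ f ∈ unitHolLarger H,
    ∫⁻ z in disc, ‖(diffOp φ z) (f ((starRingEnd ℂ) z))‖ₑ ^ 2 *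
      ENNReal.ofReal (1 - ‖z‖ ^ 2)) ^ ((1 : ℝ) / 2)

/-- `φ^#(z) = φ(z̄)^*`. -/
def sharp [CompleteSpace H] (φ : ℂ → (H →L[ℂ] H)) : ℂ → (H →L[ℂ] H) :=
  fun z => ContinuousLinearMap.adjoint (φ ((starRingEnd ℂ) z))

end Operators

/-- Nehari–Page `BMOA`. -/
def BMOANP (H : Type*) [NormedAddCommGroup H] [InnerProductSpace ℂ H] :
    Set (ℂ → (H →L[ℂ] H)) :=
  {φ | IsHol φ ∧ normNP φ < ∞}

/-- Carleson `BMOA`, defined by the anti-analytic Carleson embedding condition. -/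
def BMOAC (H : Type*) [NormedAddCommGroup H] [InnerProductSpace ℂ H] :
    Set (ℂ → (H →L[ℂ] H)) :=
  {φ | IsHol φ ∧ normC φ < ∞}

/-- The functions `φ` for which `φ^#` belongs to Carleson `BMOA`. -/
def BMOACSharp (H : Type*) [NormedAddCommGroup H] [InnerProductSpace ℂ H] [CompleteSpace H] :
    Set (ℂ → (H →L[ℂ] H)) :=
  {φ | IsHol φ ∧ sharp φ ∈ BMOAC H}

end VectorHankel

end

/-! ### Fourier series on the circle and integration over the disc. -/

namespace VectorHankel
open MeasureTheory AddCircle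

/-! Everything is read off the sesquilinear form `∑ ⟨y k, φ̂(m + k) x m⟩` on finite sequences.

Sufficiency rests on the identity `(k + 1)/(m + k + 2) + (m + 1)/(m + k + 2) = 1`. Pair `Dφ(z)
f(z̄)` with `D` of the polynomial with coefficients `y k`, over the disc with weight `1 - |z|²`.
Orthogonality on circles and a radial integral turn this pairing into π times the form weighted by
`(k + 1)/(m + k + 2)`. By Cauchy–Schwarz it is controlled by the Carleson norm and an elementary
Littlewood–Paley estimate (`hankelFormBound_of_normC`). Applied to `φ^#`, the same bound controls
the transposed weight. The two weights sum to one, so the full Hankel form is bounded, with constant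
1 (`hankelFormBound_one`, `normNP_le`).

For the failure of the converse, note that the weight at `k = 2^a`, `m = 2^b` is close to 1 when `a`
is well above `b` and close to 0 when it is well below: it is a smooth triangular truncation.
Hilbert's matrix `1/(a - b)` is bounded on `ℓ²`, but its triangular truncation is not. Placing its
entries at the frequencies `2^a + 2^b`, as rank-one operators built from an orthonormal sequence,
gives a symbol whose Hankel form splits into an orthogonal family of Hilbert forms and is bounded
(`hankelFormBound_hilbertCoeff`). Its weighted form contains the truncated matrix, and so dominates
harmonic sums (`not_hankelFormBound_hilbertCoeff`). -/

lemma integral_fourier_smul_fourier_smul {E : Type*} [NormedAddCommGroup E] [NormedSpace ℂ E]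
    [CompleteSpace E] (k n : ℤ) (v : E) :
    ∫ t : AddCircle (1 : ℝ), fourier (-k) t • (fourier n t • v) ∂haarAddCircle =
      if n = k then v else 0 := by
  have h := congrFun (fourierCoeff_fourier (T := 1) n) k
  rw [fourierCoeff] at h
  simp_rw [← smul_assoc]
  rw [integral_smul_const, h]
  by_cases hnk : n = k
  · subst hnk; simp
  · simp [hnk, Ne.symm hnk]

lemma norm_fourier_apply (n : ℤ) (t : AddCircle (1 : ℝ)) : ‖fourier n t‖ = 1 := by
  rw [fourier_apply]; exact Circle.norm_coe _

lemma continuous_tsum_fourier_smul {E : Type*} [NormedAddCommGroup E] [NormedSpace ℂ E]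
    [CompleteSpace E]
    {c : ℕ → E} (hc : Summable fun n => ‖c n‖) :
    Continuous fun t : AddCircle (1 : ℝ) => ∑' n : ℕ, fourier (n : ℤ) t • c n := by
  refine continuous_tsum (fun n => by fun_prop) hc fun n t => ?_
  rw [norm_smul, norm_fourier_apply, one_mul]

lemma integral_fourier_smul_tsum {E : Type*} [NormedAddCommGroup E] [NormedSpace ℂ E]
    [CompleteSpace E] {c : ℕ → E} (hc : Summable fun n => ‖c n‖) (k : ℕ) :
    ∫ t : AddCircle (1 : ℝ), fourier (-(k : ℤ)) t • ∑' n : ℕ, fourier (n : ℤ) t • c n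
      ∂haarAddCircle = c k := by
  have h : HasSum (fun n : ℕ => ∫ t : AddCircle (1 : ℝ),
      fourier (-(k : ℤ)) t • (fourier (n : ℤ) t • c n) ∂haarAddCircle)
      (∫ t : AddCircle (1 : ℝ), fourier (-(k : ℤ)) t • ∑' n : ℕ, fourier (n : ℤ) t • c n
        ∂haarAddCircle) := by
    refine hasSum_integral_of_dominated_convergence (fun n _ => ‖c n‖)
      (fun n => Continuous.aestronglyMeasurable (by fun_prop)) ?_ ?_ ?_ ?_
    · exact fun n => .of_forall fun t => by
        rw [norm_smul, norm_smul, norm_fourier_apply, norm_fourier_apply, one_mul, one_mul]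
    · exact .of_forall fun _ => hc
    · exact integrable_const _
    · refine .of_forall fun t => ?_
      refine (Summable.hasSum ?_).const_smul _
      exact Summable.of_norm (by simpa only [norm_smul, norm_fourier_apply, one_mul] using hc)
  simp_rw [integral_fourier_smul_fourier_smul] at h
  refine h.unique ?_
  have := hasSum_ite_eq k (c k)
  refine this.congr_fun fun n => ?_
  by_cases hn : n = k <;> simp [hn]

lemma ofReal_integral_norm_sq {α E : Type*} [MeasurableSpace α] [NormedAddCommGroup E]
    {μ : Measure α} {F : α → E} (hF : Integrable (fun t => ‖F t‖ ^ 2) μ) :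
    ∫⁻ t, ‖F t‖ₑ ^ 2 ∂μ = ENNReal.ofReal (∫ t, ‖F t‖ ^ 2 ∂μ) := by
  rw [ofReal_integral_eq_lintegral_ofReal hF (.of_forall fun t => by positivity)]
  refine lintegral_congr fun t => ?_
  rw [ENNReal.ofReal_pow (norm_nonneg _), ofReal_norm]

variable {H : Type*} [NormedAddCommGroup H] [InnerProductSpace ℂ H] [CompleteSpace H]

/-- Parseval's identity for an absolutely summable vector-valued power series on the circle. -/
lemma hasSum_norm_sq_of_summable {c : ℕ → H} (hc : Summable fun n => ‖c n‖) :
    HasSum (fun n => ‖c n‖ ^ 2)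
      (∫ t : AddCircle (1 : ℝ), ‖∑' n : ℕ, fourier (n : ℤ) t • c n‖ ^ 2 ∂haarAddCircle) := by
  set F : AddCircle (1 : ℝ) → H := fun t => ∑' n : ℕ, fourier (n : ℤ) t • c n with hFdef
  have hF : Continuous F := continuous_tsum_fourier_smul hc
  have hFb : ∀ t, ‖F t‖ ≤ ∑' n, ‖c n‖ := fun t => by
    refine tsum_of_norm_bounded hc.hasSum fun n => ?_
    rw [norm_smul, norm_fourier_apply, one_mul]
  -- Only one copy of `F` is expanded; the other stays intact, so that each term is the inner
  -- product of `c n` with the n-th Fourier coefficient of `F`, which is again `c n`.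
  have h : HasSum (fun n : ℕ => ∫ t, inner ℂ (fourier (n : ℤ) t • c n) (F t) ∂haarAddCircle)
      (∫ t, inner ℂ (F t) (F t) ∂haarAddCircle) := by
    refine hasSum_integral_of_dominated_convergence (fun n _ => ‖c n‖ * ∑' n, ‖c n‖)
      (fun n => Continuous.aestronglyMeasurable (by fun_prop)) ?_ ?_ ?_ ?_
    · refine fun n => .of_forall fun t => (norm_inner_le_norm _ _).trans ?_
      rw [norm_smul, norm_fourier_apply, one_mul]
      gcongr
      exact hFb t
    · exact .of_forall fun _ => hc.mul_right _
    · exact integrable_const _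
    · refine .of_forall fun t => ?_
      have hs : HasSum (fun n : ℕ => fourier (n : ℤ) t • c n) (F t) :=
        Summable.hasSum (Summable.of_norm (by simpa only [norm_smul, norm_fourier_apply, one_mul] using hc))
      have := (innerSL ℂ (F t)).hasSum hs
      have := this.map (starRingEnd ℂ) RCLike.continuous_conj
      simpa only [Function.comp_def, innerSL_apply_apply, inner_conj_symm] using this
  have key : ∀ n : ℕ, ∫ t, inner ℂ (fourier (n : ℤ) t • c n) (F t) ∂haarAddCircle =
      ((‖c n‖ ^ 2 : ℝ) : ℂ) := fun n => by
    have hint : Integrable (fun t => fourier (-(n : ℤ)) t • F t)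
        (haarAddCircle : Measure (AddCircle (1 : ℝ))) :=
      Continuous.integrable_of_hasCompactSupport (by fun_prop) (HasCompactSupport.of_compactSpace _)
    have := (innerSL ℂ (c n)).integral_comp_comm hint
    simp only [innerSL_apply_apply] at this
    rw [hFdef, integral_fourier_smul_tsum hc n, inner_self_eq_norm_sq_to_K] at this
    push_cast
    rw [show ((‖c n‖ : ℂ)) ^ 2 = _ from this.symm]
    refine integral_congr_ae (.of_forall fun t => ?_)
    simp only [inner_smul_left, inner_smul_right, fourier_neg]
    rfl
  simp_rw [key, inner_self_eq_norm_sq_to_K] at h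
  have h2 : ∫ t, ((‖F t‖ : ℂ)) ^ 2 ∂haarAddCircle =
      ((∫ t, ‖F t‖ ^ 2 ∂haarAddCircle : ℝ) : ℂ) := by
    rw [← integral_complex_ofReal]
    simp
  erw [h2] at h
  exact_mod_cast h

lemma lintegral_norm_sq_tsum_fourier {c : ℕ → H} (hc : Summable fun n => ‖c n‖) :
    ∫⁻ t : AddCircle (1 : ℝ), ‖∑' n : ℕ, fourier (n : ℤ) t • c n‖ₑ ^ 2 ∂haarAddCircle =
      ∑' n, ‖c n‖ₑ ^ 2 := by
  have hF := continuous_tsum_fourier_smul hc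
  rw [ofReal_integral_norm_sq, ← (hasSum_norm_sq_of_summable hc).tsum_eq,
    ENNReal.ofReal_tsum_of_nonneg (fun _ => by positivity) (hasSum_norm_sq_of_summable hc).summable]
  · simp_rw [ENNReal.ofReal_pow (norm_nonneg _), ofReal_norm]
  · exact Continuous.integrable_of_hasCompactSupport (by fun_prop)
      (HasCompactSupport.of_compactSpace _)

/-- Integration over the disc in polar coordinates. -/
lemma lintegral_disc_eq {F : ℂ → ℝ≥0∞} :
    ∫⁻ z in disc, F z = ∫⁻ p in Set.Ioo (0 : ℝ) 1 ×ˢ Set.Ioo (-Real.pi) Real.pi,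
      ENNReal.ofReal p.1 * F (Complex.polarCoord.symm p) := by
  have hd : MeasurableSet disc := Metric.isOpen_ball.measurableSet
  rw [← lintegral_indicator hd, ← Complex.lintegral_comp_polarCoord_symm, polarCoord_target,
    ← lintegral_indicator (measurableSet_Ioi.prod measurableSet_Ioo),
    ← lintegral_indicator (measurableSet_Ioo.prod measurableSet_Ioo)]
  refine lintegral_congr fun p => ?_
  simp only [Set.indicator, Set.mem_prod, Set.mem_Ioi, Set.mem_Ioo, disc, mem_ball_zero_iff,
    Complex.norm_polarCoord_symm]
  by_cases h0 : 0 < p.1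
  · by_cases h1 : p.1 < 1 <;> simp [h0, h1, abs_of_pos h0]
  · simp [h0]

/-- Substitution `θ = 2πt`; the factor `2π` appears because Haar measure on the circle has total
mass one. -/
lemma lintegral_angle_eq (F : ℂ → ℝ≥0∞) (r : ℝ) :
    ∫⁻ θ in Set.Ioo (-Real.pi) Real.pi, F (Complex.polarCoord.symm (r, θ)) =
      ENNReal.ofReal (2 * Real.pi) *
        ∫⁻ t : AddCircle (1 : ℝ), F (r * (toCircle t : ℂ)) ∂haarAddCircle := by
  have h2 : (haarAddCircle : Measure (AddCircle (1 : ℝ))) = volume := by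
    rw [volume_eq_smul_haarAddCircle]; simp
  have hpi : (0 : ℝ) < 2 * Real.pi := by positivity
  rw [h2]
  have h3 := AddCircle.lintegral_preimage (1 : ℝ) (-(1 / 2))
    (fun t : AddCircle (1 : ℝ) => F (r * (toCircle t : ℂ)))
  rw [← h3, show (-(1 / 2) + 1 : ℝ) = 1 / 2 by norm_num, ← restrict_Ioo_eq_restrict_Ioc,
    ← lintegral_indicator measurableSet_Ioo, ← lintegral_indicator measurableSet_Ioo]
  have h4 := Real.smul_map_volume_mul_left hpi.ne'
  conv_lhs => rw [← h4]
  rw [lintegral_smul_measure, abs_of_pos hpi, smul_eq_mul,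
    (measurableEmbedding_mulLeft₀ hpi.ne').lintegral_map]
  congr 1
  refine lintegral_congr fun θ => ?_
  have : 2 * Real.pi * θ ∈ Set.Ioo (-Real.pi) Real.pi ↔ θ ∈ Set.Ioo (-(1 / 2) : ℝ) (1 / 2) := by
    have := Real.pi_pos
    simp only [Set.mem_Ioo]
    constructor
    · rintro ⟨h, h'⟩; constructor <;> nlinarith
    · rintro ⟨h, h'⟩; constructor <;> nlinarith
  by_cases hθ : θ ∈ Set.Ioo (-(1 / 2) : ℝ) (1 / 2)
  · rw [Set.indicator_of_mem hθ, Set.indicator_of_mem (this.2 hθ)]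
    congr 1
    rw [Complex.polarCoord_symm_apply, AddCircle.toCircle_apply_mk, Circle.coe_exp,
      Complex.exp_mul_I]
    push_cast
    simp
  · rw [Set.indicator_of_notMem hθ, Set.indicator_of_notMem (mt this.1 hθ)]

lemma lintegral_disc_polar {F : ℂ → ℝ≥0∞} (hF : Measurable F) :
    ∫⁻ z in disc, F z = ENNReal.ofReal (2 * Real.pi) *
      ∫⁻ r in Set.Ioo (0 : ℝ) 1, ENNReal.ofReal r *
        ∫⁻ t : AddCircle (1 : ℝ), F (r * (toCircle t : ℂ)) ∂haarAddCircle := by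
  rw [lintegral_disc_eq, Measure.volume_eq_prod, ← Measure.prod_restrict, lintegral_prod]
  · rw [← lintegral_const_mul' _ _ ENNReal.ofReal_ne_top]
    refine lintegral_congr fun r => ?_
    rw [lintegral_const_mul' _ _ ENNReal.ofReal_ne_top, lintegral_angle_eq]
    ring
  · have : Measurable fun p : ℝ × ℝ => Complex.polarCoord.symm p := by
      simp_rw [Complex.polarCoord_symm_apply]; fun_prop
    exact Measurable.aemeasurable (by fun_prop)

end VectorHankel

/-! ### Taylor coefficients, the Hardy norm, and the Hankel form. -/

namespace VectorHankel
open MeasureTheory AddCircle Filter Topology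

section Taylor
variable {E : Type*} [NormedAddCommGroup E] [NormedSpace ℂ E]

lemma hasSum_taylorCoeff [CompleteSpace E] {f : ℂ → E} {R : ℝ}
    (hf : DifferentiableOn ℂ f (Metric.ball 0 R)) {z : ℂ} (hz : ‖z‖ < R) :
    HasSum (fun n => z ^ n • taylorCoeff f n) (f z) := by
  have := Complex.hasSum_taylorSeries_on_ball hf (z := z) (by simpa using hz)
  refine this.congr_fun fun n => ?_
  rw [taylorCoeff, sub_zero, smul_comm]

lemma exists_norm_mul_pow_le_of_summable {a : ℕ → E} {z : ℂ}
    (h : Summable fun n => z ^ n • a n) : ∃ B, ∀ n, ‖a n‖ * ‖z‖ ^ n ≤ B := by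
  obtain ⟨B, hB⟩ := h.tendsto_atTop_zero.norm.bddAbove_range
  refine ⟨B, fun n => ?_⟩
  have := hB ⟨n, rfl⟩
  simpa [norm_smul, mul_comm] using this

lemma exists_norm_taylorCoeff_mul_pow_le [CompleteSpace E] {f : ℂ → E} {R : ℝ}
    (hf : DifferentiableOn ℂ f (Metric.ball 0 R)) {r : ℝ} (hr0 : 0 ≤ r) (hr : r < R) :
    ∃ B, ∀ n, ‖taylorCoeff f n‖ * r ^ n ≤ B := by
  have h : ‖(r : ℂ)‖ = r := by simp [abs_of_nonneg hr0]
  have := exists_norm_mul_pow_le_of_summable (hasSum_taylorCoeff hf (h.trans_lt hr)).summable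
  rwa [h] at this

lemma summable_mul_pow_of_bound {E : Type*} [NormedAddCommGroup E] {a : ℕ → E} {s B : ℝ} (hs : 0 < s)
    (h : ∀ n, ‖a n‖ * s ^ n ≤ B) {r : ℝ} (hr0 : 0 ≤ r) (hr : r < s) :
    Summable fun n : ℕ => ((n : ℝ) + 1) * (‖a n‖ * r ^ n) := by
  have hq : ‖r / s‖ < 1 := by
    rw [Real.norm_of_nonneg (by positivity)]; exact (div_lt_one hs).2 hr
  have h1 : Summable fun n : ℕ => ((n : ℝ) + 1) * (r / s) ^ n := by
    have h2 := summable_pow_mul_geometric_of_norm_lt_one 1 hq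
    have h3 := summable_geometric_of_norm_lt_one hq
    simpa [add_mul] using h2.add h3
  refine Summable.of_nonneg_of_le (fun n => by positivity) (fun n => ?_) (h1.mul_left B)
  calc ((n : ℝ) + 1) * (‖a n‖ * r ^ n)
      = ((n : ℝ) + 1) * (r / s) ^ n * (‖a n‖ * s ^ n) := by rw [div_pow]; field_simp
    _ ≤ ((n : ℝ) + 1) * (r / s) ^ n * B := by gcongr; exact h n
    _ = _ := by ring

lemma summable_succ_mul_norm_taylorCoeff [CompleteSpace E] {f : ℂ → E} {R : ℝ}
    (hf : DifferentiableOn ℂ f (Metric.ball 0 R)) {r : ℝ} (hr0 : 0 ≤ r) (hr : r < R) :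
    Summable fun n : ℕ => ((n : ℝ) + 1) * (‖taylorCoeff f n‖ * r ^ n) := by
  obtain ⟨s, hrs, hsR⟩ := exists_between hr
  obtain ⟨B, hB⟩ := exists_norm_taylorCoeff_mul_pow_le hf (hr0.trans hrs.le) hsR
  exact summable_mul_pow_of_bound (hr0.trans_lt hrs) hB hr0 hrs

lemma summable_norm_taylorCoeff [CompleteSpace E] {f : ℂ → E} {R : ℝ}
    (hf : DifferentiableOn ℂ f (Metric.ball 0 R)) {r : ℝ} (hr0 : 0 ≤ r) (hr : r < R) :
    Summable fun n => ‖taylorCoeff f n‖ * r ^ n := by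
  refine Summable.of_nonneg_of_le (fun n => by positivity) (fun n => ?_)
    (summable_succ_mul_norm_taylorCoeff hf hr0 hr)
  have : 0 ≤ (n : ℝ) := n.cast_nonneg
  nlinarith [mul_nonneg this (mul_nonneg (norm_nonneg (taylorCoeff f n)) (pow_nonneg hr0 n))]

end Taylor

lemma coe_toCircle_pow (t : AddCircle (1 : ℝ)) (n : ℕ) :
    (toCircle t : ℂ) ^ n = fourier (n : ℤ) t := by
  rw [fourier_apply, toCircle_zsmul]; simp

lemma enorm_sq_eq_ofReal {E : Type*} [NormedAddCommGroup E] (v : E) :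
    ‖v‖ₑ ^ 2 = ENNReal.ofReal (‖v‖ ^ 2) := by
  rw [ENNReal.ofReal_pow (norm_nonneg _), ofReal_norm]

/-- Boundedness with constant `C` of the block matrix `(w k m • a (m + k))` on `ℓ²(H)`, tested on
finitely supported sequences. -/
def HankelFormBound {H : Type*} [NormedAddCommGroup H] [InnerProductSpace ℂ H]
    (w : ℕ → ℕ → ℝ) (a : ℕ → (H →L[ℂ] H)) (C : ℝ) : Prop :=
  ∀ (N : ℕ) (y x : ℕ → H),
    ‖∑ k ∈ Finset.range N, ∑ m ∈ Finset.range N, (w k m : ℂ) * inner ℂ (y k) (a (m + k) (x m))‖ ≤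
      C * (√(∑ k ∈ Finset.range N, ‖y k‖ ^ 2) * √(∑ m ∈ Finset.range N, ‖x m‖ ^ 2))

/-- Duality: testing the form against the image itself, cut off at `K`, gives `S ≤ C √S`. The cutoff
`K` is separate from `N` so that `N` can tend to infinity with `K` fixed. -/
lemma HankelFormBound.sum_norm_sq_le {H : Type*} [NormedAddCommGroup H]
    [InnerProductSpace ℂ H] {a : ℕ → (H →L[ℂ] H)} {C : ℝ}
    (h : HankelFormBound (fun _ _ => 1) a C) {N K : ℕ} (hK : K ≤ N) {x : ℕ → H}
    (hx : ∑ m ∈ Finset.range N, ‖x m‖ ^ 2 ≤ 1) (hC : 0 ≤ C) :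
    ∑ k ∈ Finset.range K, ‖∑ m ∈ Finset.range N, a (m + k) (x m)‖ ^ 2 ≤ C ^ 2 := by
  set b : ℕ → H := fun k => ∑ m ∈ Finset.range N, a (m + k) (x m) with hb
  set y : ℕ → H := fun k => if k < K then b k else 0 with hy
  set S := ∑ k ∈ Finset.range K, ‖b k‖ ^ 2 with hS
  have hsub : ∀ g : ℕ → ℝ, ∑ k ∈ Finset.range N, (if k < K then g k else 0) =
      ∑ k ∈ Finset.range K, g k := by
    intro g
    rw [← Finset.sum_filter]
    congr 1
    ext k
    simp only [Finset.mem_filter, Finset.mem_range]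
    omega
  have h1 := h N y x
  have h2 : ∑ k ∈ Finset.range N, ‖y k‖ ^ 2 = S := by
    rw [hS, ← hsub]
    refine Finset.sum_congr rfl fun k _ => ?_
    by_cases hk : k < K <;> simp [hy, hk]
  have h3 : ∑ k ∈ Finset.range N, ∑ m ∈ Finset.range N,
      ((1 : ℝ) : ℂ) * inner ℂ (y k) (a (m + k) (x m)) = (S : ℂ) := by
    rw [hS, ← hsub, Complex.ofReal_sum]
    refine Finset.sum_congr rfl fun k _ => ?_
    simp only [Complex.ofReal_one, one_mul]
    rw [← inner_sum]
    change inner ℂ (y k) (b k) = _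
    by_cases hk : k < K
    · simp [hy, hk, inner_self_eq_norm_sq_to_K]
    · simp [hy, hk]
  have hS0 : 0 ≤ S := Finset.sum_nonneg fun _ _ => by positivity
  rw [h3, h2, Complex.norm_of_nonneg hS0] at h1
  have h4 : √(∑ m ∈ Finset.range N, ‖x m‖ ^ 2) ≤ 1 := Real.sqrt_le_one.2 hx
  have h5 : S ≤ C * √S := h1.trans (by
    gcongr
    exact mul_le_of_le_one_right (Real.sqrt_nonneg _) h4)
  by_contra! hlt
  have h6 : C < √S := Real.lt_sqrt_of_sq_lt hlt
  nlinarith [Real.mul_self_sqrt hS0]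

variable {H : Type*} [NormedAddCommGroup H] [InnerProductSpace ℂ H] [CompleteSpace H]

/-- The `H²` norm of a power series is the `ℓ²` norm of its coefficients. -/
lemma hardyNorm_two_sq {f : ℂ → H} {a : ℕ → H}
    (ha : ∀ r ∈ Set.Ioo (0 : ℝ) 1, Summable fun n => ‖a n‖ * r ^ n)
    (hf : ∀ z : ℂ, ‖z‖ < 1 → HasSum (fun n => z ^ n • a n) (f z)) :
    hardyNorm 2 f ^ 2 = ∑' n, ‖a n‖ₑ ^ 2 := by
  have hr : ∀ r ∈ Set.Ioo (0 : ℝ) 1, (eLpNorm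
      (fun t : AddCircle (1 : ℝ) => f ((r : ℂ) * (AddCircle.toCircle t : ℂ)))
      2 AddCircle.haarAddCircle) ^ 2 = ∑' n, ‖((r : ℂ) ^ n) • a n‖ₑ ^ 2 := by
    intro r hr
    have hs : Summable fun n => ‖((r : ℂ) ^ n) • a n‖ := by
      refine (ha r hr).congr fun n => ?_
      simp [norm_smul, abs_of_pos hr.1, mul_comm]
    rw [← lintegral_norm_sq_tsum_fourier hs, eLpNorm_eq_lintegral_rpow_enorm_toReal (by simp)
      (by simp), ← ENNReal.rpow_natCast, ← ENNReal.rpow_mul]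
    norm_num
    refine lintegral_congr fun t => ?_
    congr 2
    have ht : ‖(r : ℂ) * (toCircle t : ℂ)‖ < 1 := by
      rw [norm_mul, Circle.norm_coe, mul_one]; simpa [abs_of_pos hr.1] using hr.2
    rw [← (hf _ ht).tsum_eq]
    refine tsum_congr fun n => ?_
    rw [mul_pow, coe_toCircle_pow, mul_comm, mul_smul]
    simp
  have h1 : hardyNorm 2 f ^ 2 =
      ⨆ r ∈ Set.Ioo (0 : ℝ) 1, ∑' n, ‖((r : ℂ) ^ n) • a n‖ₑ ^ 2 := by
    have hm : ∀ g : ℝ → ℝ≥0∞, (⨆ r ∈ Set.Ioo (0 : ℝ) 1, g r) ^ 2 =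
        ⨆ r ∈ Set.Ioo (0 : ℝ) 1, g r ^ 2 := by
      intro g
      have := (ENNReal.orderIsoRpow 2 two_pos).map_iSup₂ fun r (_ : r ∈ Set.Ioo (0 : ℝ) 1) => g r
      simpa only [ENNReal.orderIsoRpow_apply, ENNReal.rpow_two] using this
    rw [hardyNorm, hm]
    exact iSup_congr fun r => iSup_congr (hr r)
  rw [h1]
  refine le_antisymm (iSup₂_le fun r hr => ENNReal.tsum_le_tsum fun n => ?_) ?_
  · gcongr 1
    rw [enorm_smul]
    refine mul_le_of_le_one_left (by simp) ?_
    rw [enorm_pow]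
    refine pow_le_one₀ (by simp) ?_
    rw [← ofReal_norm]
    simpa [abs_of_pos hr.1] using hr.2.le
  -- Finite partial sums are continuous in `r`, so they pass to the limit `r → 1` and stay below the
  -- supremum.
  · rw [ENNReal.tsum_eq_iSup_sum]
    refine iSup_le fun s => ?_
    have hc : Continuous fun r : ℝ => ∑ n ∈ s, ‖((r : ℂ) ^ n) • a n‖ₑ ^ 2 := by fun_prop
    have ht : Tendsto (fun r : ℝ => ∑ n ∈ s, ‖((r : ℂ) ^ n) • a n‖ₑ ^ 2) (𝓝[<] 1)
        (𝓝 (∑ n ∈ s, ‖a n‖ₑ ^ 2)) := by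
      have := (hc.tendsto 1).mono_left (nhdsWithin_le_nhds (s := Set.Iio 1))
      simpa using this
    refine le_of_tendsto ht ?_
    filter_upwards [Ioo_mem_nhdsLT (zero_lt_one (α := ℝ))] with r hr
    exact (ENNReal.sum_le_tsum s).trans
      (le_iSup₂ (f := fun (r : ℝ) (_ : r ∈ Set.Ioo (0 : ℝ) 1) =>
        ∑' n, ‖((r : ℂ) ^ n) • a n‖ₑ ^ 2) r hr)

lemma IsHolLarger.hardyNorm_two_sq {f : ℂ → H} (hf : IsHolLarger f) :
    hardyNorm 2 f ^ 2 = ∑' n, ‖taylorCoeff f n‖ₑ ^ 2 := by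
  obtain ⟨R, hR, hf⟩ := hf
  exact VectorHankel.hardyNorm_two_sq
    (fun r hr => summable_norm_taylorCoeff hf hr.1.le (hr.2.trans hR))
    fun z hz => hasSum_taylorCoeff hf (hz.trans hR)

/-- A bound for the Hankel form bounds the Nehari–Page norm. -/
lemma normNP_le_of_hankelFormBound {φ : ℂ → (H →L[ℂ] H)} (hφ : IsHol φ) {C : ℝ} (hC : 0 ≤ C)
    (h : HankelFormBound (fun _ _ => 1) (taylorCoeff φ) C) : normNP φ ≤ ENNReal.ofReal C := by
  refine iSup₂_le fun f hf => ?_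
  obtain ⟨hfl, hf1⟩ := hf
  have hsq := hfl.hardyNorm_two_sq
  obtain ⟨R, hR, hfd⟩ := hfl
  have hx : ∀ N, ∑ m ∈ Finset.range N, ‖taylorCoeff f m‖ ^ 2 ≤ 1 := by
    intro N
    have h1 := ENNReal.sum_le_tsum (f := fun n => ‖taylorCoeff f n‖ₑ ^ 2) (Finset.range N)
    rw [← hsq, hf1, one_pow] at h1
    simp_rw [enorm_sq_eq_ofReal] at h1
    rw [← ENNReal.ofReal_sum_of_nonneg (fun _ _ => by positivity)] at h1
    simpa using h1
  have hsum : ∀ k, Summable fun m => taylorCoeff φ (m + k) (taylorCoeff f m) := by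
    intro k
    -- The coefficients of `φ` grow at most like `s ^ n` for every `s > 1`; those of `f` remain
    -- summable against `s ^ m` for some such `s`, because `f` is analytic beyond the closed disc.
    obtain ⟨s, hs1, hsR⟩ := exists_between hR
    have hs0 : 0 < s := one_pos.trans hs1
    obtain ⟨B, hB⟩ := exists_norm_taylorCoeff_mul_pow_le hφ (r := s⁻¹) (by positivity)
      (inv_lt_one_of_one_lt₀ hs1)
    refine Summable.of_norm_bounded (g := fun m => B * s ^ k * (‖taylorCoeff f m‖ * s ^ m))
      ((summable_norm_taylorCoeff hfd hs0.le hsR).mul_left _) fun m => ?_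
    refine (ContinuousLinearMap.le_opNorm _ _).trans ?_
    have h1 : ‖taylorCoeff φ (m + k)‖ ≤ B * s ^ (m + k) := by
      have := hB (m + k)
      rwa [inv_pow, ← div_eq_mul_inv, div_le_iff₀ (by positivity)] at this
    calc _ ≤ B * s ^ (m + k) * ‖taylorCoeff f m‖ := by gcongr
      _ = _ := by rw [pow_add]; ring
  set a : ℕ → H := fun k => ∑' m, taylorCoeff φ (m + k) (taylorCoeff f m) with ha
  have hKa : ∀ K, ∑ k ∈ Finset.range K, ‖a k‖ ^ 2 ≤ C ^ 2 := by
    intro K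
    have ht : Tendsto (fun N => ∑ k ∈ Finset.range K,
        ‖∑ m ∈ Finset.range N, taylorCoeff φ (m + k) (taylorCoeff f m)‖ ^ 2) atTop
        (𝓝 (∑ k ∈ Finset.range K, ‖a k‖ ^ 2)) :=
      tendsto_finsetSum _ fun k _ => ((hsum k).hasSum.tendsto_sum_nat.norm).pow 2
    refine le_of_tendsto ht ?_
    filter_upwards [eventually_ge_atTop K] with N hN
    exact h.sum_norm_sq_le hN (hx N) hC
  have haC : ∀ n, ‖a n‖ ≤ C := fun n => by
    have h1 : ‖a n‖ ^ 2 ≤ C ^ 2 := (Finset.single_le_sum (f := fun k => ‖a k‖ ^ 2)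
      (fun _ _ => by positivity) (Finset.self_mem_range_succ n)).trans (hKa (n + 1))
    exact abs_le_of_sq_le_sq' h1 hC |>.2
  have hr : ∀ r ∈ Set.Ioo (0 : ℝ) 1, Summable fun n => ‖a n‖ * r ^ n := fun r hr =>
    Summable.of_nonneg_of_le (fun n => mul_nonneg (norm_nonneg _) (pow_nonneg hr.1.le n))
      (fun n => mul_le_mul_of_nonneg_right (haC n) (pow_nonneg hr.1.le n))
      ((summable_geometric_of_lt_one hr.1.le hr.2).mul_left C)
  have hz : ∀ z : ℂ, ‖z‖ < 1 → HasSum (fun n => z ^ n • a n) (hankel φ f z) := by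
    intro z hz
    refine Summable.hasSum (Summable.of_norm_bounded (g := fun n => C * ‖z‖ ^ n)
      ((summable_geometric_of_lt_one (norm_nonneg _) hz).mul_left C) fun n => ?_)
    rw [norm_smul, norm_pow, mul_comm]
    exact mul_le_mul_of_nonneg_right (haC n) (by positivity)
  have h2 := hardyNorm_two_sq hr hz
  have h3 : hardyNorm 2 (hankel φ f) ^ 2 ≤ ENNReal.ofReal C ^ 2 := by
    rw [h2, ENNReal.tsum_eq_iSup_nat]
    refine iSup_le fun K => ?_
    simp_rw [enorm_sq_eq_ofReal]
    rw [← ENNReal.ofReal_sum_of_nonneg (fun _ _ => by positivity), ← ENNReal.ofReal_pow hC]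
    exact ENNReal.ofReal_le_ofReal (hKa K)
  exact (ENNReal.pow_le_pow_left_iff two_ne_zero).1 h3

end VectorHankel

/-! ### The operator `D`, polynomials, and the two integrals over the disc. -/

namespace VectorHankel
open MeasureTheory AddCircle Filter Topology

section DiffOp
variable {E : Type*} [NormedAddCommGroup E] [NormedSpace ℂ E] [CompleteSpace E]

lemma isOpen_disc : IsOpen disc := Metric.isOpen_ball

lemma mem_disc {z : ℂ} : z ∈ disc ↔ ‖z‖ < 1 := by simp [disc]

lemma hasSum_diffOp {φ : ℂ → E} (hφ : IsHol φ) {z : ℂ} (hz : ‖z‖ < 1) :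
    HasSum (fun n : ℕ => z ^ n • ((n : ℂ) + 1) • taylorCoeff φ n) (diffOp φ z) := by
  have hd : DifferentiableOn ℂ (deriv φ) (Metric.ball 0 1) := hφ.deriv isOpen_disc
  have h1 := (hasSum_taylorCoeff hd hz).const_smul z
  have h2 : HasSum (fun n : ℕ => z ^ n • (n : ℂ) • taylorCoeff φ n) (z • deriv φ z) := by
    rw [← hasSum_nat_add_iff' 1]
    simp only [Finset.range_one, Finset.sum_singleton, Nat.cast_zero, zero_smul, smul_zero,
      sub_zero]
    refine h1.congr_fun fun n => ?_
    rw [taylorCoeff, taylorCoeff, ← iteratedDeriv_succ', smul_smul, smul_smul, smul_smul,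
      smul_smul]
    congr 1
    rw [Nat.factorial_succ]
    have : (n.factorial : ℂ) ≠ 0 := mod_cast n.factorial_ne_zero
    have : (n : ℂ) + 1 ≠ 0 := mod_cast n.succ_ne_zero
    push_cast
    field_simp
    ring
  refine (h2.add (hasSum_taylorCoeff hφ hz)).congr_fun fun n => ?_
  rw [← smul_add, add_smul, one_smul]

lemma continuousOn_diffOp {φ : ℂ → E} (hφ : IsHol φ) : ContinuousOn (diffOp φ) disc :=
  (continuousOn_id.smul (hφ.deriv isOpen_disc).continuousOn).add hφ.continuousOn

lemma norm_coe_mul_toCircle {r : ℝ} (hr : 0 ≤ r) (t : AddCircle (1 : ℝ)) :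
    ‖(r : ℂ) * (toCircle t : ℂ)‖ = r := by
  rw [norm_mul, Circle.norm_coe, mul_one, Complex.norm_of_nonneg hr]

lemma integral_fourier_smul_diffOp {φ : ℂ → E} (hφ : IsHol φ) {r : ℝ} (hr : r ∈ Set.Ioo (0 : ℝ) 1)
    (j : ℕ) :
    ∫ t : AddCircle (1 : ℝ), fourier (-(j : ℤ)) t • diffOp φ (r * (toCircle t : ℂ))
      ∂haarAddCircle = (r : ℂ) ^ j • ((j : ℂ) + 1) • taylorCoeff φ j := by
  have hc : Summable fun n : ℕ => ‖(r : ℂ) ^ n • ((n : ℂ) + 1) • taylorCoeff φ n‖ := by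
    refine (summable_succ_mul_norm_taylorCoeff hφ hr.1.le hr.2).congr fun n => ?_
    rw [norm_smul, norm_smul, norm_pow, Complex.norm_of_nonneg hr.1.le,
      show ‖(n : ℂ) + 1‖ = (n : ℝ) + 1 by exact_mod_cast Complex.norm_natCast (n + 1)]
    ring
  rw [← integral_fourier_smul_tsum hc j]
  refine integral_congr_ae (.of_forall fun t => ?_)
  dsimp only
  congr 1
  rw [← (hasSum_diffOp hφ ((norm_coe_mul_toCircle hr.1.le t).trans_lt hr.2)).tsum_eq]
  refine tsum_congr fun n => ?_
  rw [mul_pow, coe_toCircle_pow, mul_comm, mul_smul]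

end DiffOp

section Polynomials
variable {H : Type*} [NormedAddCommGroup H] [InnerProductSpace ℂ H]

/-- The polynomial with coefficients `c 0, …, c (N - 1)`. -/
def poly (N : ℕ) (c : ℕ → H) (z : ℂ) : H := ∑ k ∈ Finset.range N, z ^ k • c k

lemma continuous_poly (N : ℕ) (c : ℕ → H) : Continuous (poly N c) := by
  unfold poly; fun_prop

lemma isHolLarger_poly (N : ℕ) (c : ℕ → H) : IsHolLarger (poly N c) :=
  ⟨2, one_lt_two, Differentiable.differentiableOn (by unfold poly; fun_prop)⟩

lemma hasSum_poly (N : ℕ) (c : ℕ → H) (z : ℂ) :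
    HasSum (fun n => z ^ n • if n < N then c n else 0) (poly N c z) := by
  have h : ∑ k ∈ Finset.range N, z ^ k • (if k < N then c k else 0) = poly N c z :=
    Finset.sum_congr rfl fun k hk => by rw [if_pos (Finset.mem_range.1 hk)]
  rw [← h]
  exact hasSum_sum_of_ne_finset_zero fun n hn => by simp_all

lemma tsum_truncate {H : Type*} [NormedAddCommGroup H] (N : ℕ) (c : ℕ → H) :
    ∑' n, ‖if n < N then c n else 0‖ₑ ^ 2 = ENNReal.ofReal (∑ n ∈ Finset.range N, ‖c n‖ ^ 2) := by
  rw [tsum_eq_sum (s := Finset.range N) (fun n hn => by simp_all),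
    ENNReal.ofReal_sum_of_nonneg fun _ _ => by positivity]
  refine Finset.sum_congr rfl fun n hn => ?_
  rw [if_pos (Finset.mem_range.1 hn), enorm_sq_eq_ofReal]

variable [CompleteSpace H]

lemma hardyNorm_poly_sq (N : ℕ) (c : ℕ → H) :
    hardyNorm 2 (poly N c) ^ 2 = ENNReal.ofReal (∑ n ∈ Finset.range N, ‖c n‖ ^ 2) := by
  rw [← tsum_truncate]
  refine hardyNorm_two_sq (fun r _ => ?_) fun z _ => hasSum_poly N c z
  exact summable_of_ne_finset_zero (s := Finset.range N) fun n hn => by simp_all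

lemma lintegral_circle_poly_sq (N : ℕ) (c : ℕ → H) (r : ℝ) :
    ∫⁻ t : AddCircle (1 : ℝ), ‖poly N c (r * (toCircle t : ℂ))‖ₑ ^ 2 ∂haarAddCircle =
      ENNReal.ofReal (∑ n ∈ Finset.range N, r ^ (2 * n) * ‖c n‖ ^ 2) := by
  have h := tsum_truncate N fun n => (r : ℂ) ^ n • c n
  have hs : ∑ n ∈ Finset.range N, ‖(r : ℂ) ^ n • c n‖ ^ 2 =
      ∑ n ∈ Finset.range N, r ^ (2 * n) * ‖c n‖ ^ 2 := by
    refine Finset.sum_congr rfl fun n _ => ?_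
    rw [norm_smul, mul_pow, norm_pow, Complex.norm_real, Real.norm_eq_abs, ← pow_mul, mul_comm n,
      pow_mul, sq_abs, pow_mul]
  rw [← hs, ← h, ← lintegral_norm_sq_tsum_fourier
    (summable_of_ne_finset_zero (s := Finset.range N) fun n hn => by simp_all)]
  refine lintegral_congr fun t => ?_
  rw [← (hasSum_poly N _ _).tsum_eq]
  congr 3
  ext n
  rw [mul_pow, coe_toCircle_pow, mul_comm, mul_smul]
  split_ifs <;> simp

end Polynomials

lemma integral_pow_mul_one_sub_sq (n : ℕ) :
    ∫ r in (0 : ℝ)..1, r ^ (2 * n + 1) * (1 - r ^ 2) = 1 / (2 * ((n : ℝ) + 1) * (n + 2)) := by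
  have : ∀ r : ℝ, r ^ (2 * n + 1) * (1 - r ^ 2) = r ^ (2 * n + 1) - r ^ (2 * n + 3) :=
    fun r => by ring
  simp_rw [this]
  rw [intervalIntegral.integral_sub (by simp) (by simp)]
  simp only [integral_pow]
  push_cast
  simp
  field_simp
  ring

lemma lintegral_Ioo_pow_mul (n : ℕ) :
    ∫⁻ r in Set.Ioo (0 : ℝ) 1, ENNReal.ofReal (r ^ (2 * n + 1) * (1 - r ^ 2)) =
      ENNReal.ofReal (1 / (2 * (n + 1) * (n + 2))) := by
  have hc : Continuous fun r : ℝ => r ^ (2 * n + 1) * (1 - r ^ 2) := by fun_prop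
  rw [← integral_pow_mul_one_sub_sq, intervalIntegral.integral_of_le zero_le_one,
    integral_Ioc_eq_integral_Ioo, ofReal_integral_eq_lintegral_ofReal]
  · exact (hc.integrableOn_Icc (a := 0) (b := 1)).mono_set Set.Ioo_subset_Icc_self
  · refine ae_restrict_of_forall_mem measurableSet_Ioo fun r hr => ?_
    have : r ^ 2 ≤ 1 := pow_le_one₀ hr.1.le hr.2.le
    exact mul_nonneg (pow_nonneg hr.1.le _) (sub_nonneg.2 this)

section Key
variable {H : Type*} [NormedAddCommGroup H] [InnerProductSpace ℂ H] [CompleteSpace H]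

/-- Littlewood–Paley estimate for `D`: Parseval on circles and the radial moment `1 / (2(k + 1)(k +
2))` give each `‖y k‖²` the weight `π (k + 1)/(k + 2) ≤ π`. -/
lemma lintegral_disc_poly_sq_le (N : ℕ) (y : ℕ → H) :
    ∫⁻ z in disc, ‖poly N (fun k => ((k : ℂ) + 1) • y k) z‖ₑ ^ 2 * ENNReal.ofReal (1 - ‖z‖ ^ 2) ≤
      ENNReal.ofReal (Real.pi * ∑ k ∈ Finset.range N, ‖y k‖ ^ 2) := by
  have hp := continuous_poly N fun k => ((k : ℂ) + 1) • y k
  have hn : ∀ k : ℕ, ‖((k : ℂ) + 1) • y k‖ ^ 2 = ((k : ℝ) + 1) ^ 2 * ‖y k‖ ^ 2 := fun k => by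
    rw [norm_smul, mul_pow,
      show ‖(k : ℂ) + 1‖ = (k : ℝ) + 1 by exact_mod_cast Complex.norm_natCast (k + 1)]
  have hm : Measurable fun z => ‖poly N (fun k => ((k : ℂ) + 1) • y k) z‖ₑ ^ 2 *
      ENNReal.ofReal (1 - ‖z‖ ^ 2) :=
    (hp.enorm.measurable.pow_const 2).mul (by fun_prop)
  rw [lintegral_disc_polar hm]
  have h1 : ∫⁻ r in Set.Ioo (0 : ℝ) 1, ENNReal.ofReal r *
      ∫⁻ t : AddCircle (1 : ℝ), ‖poly N (fun k => ((k : ℂ) + 1) • y k)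
        (r * (toCircle t : ℂ))‖ₑ ^ 2 * ENNReal.ofReal (1 - ‖(r : ℂ) * (toCircle t : ℂ)‖ ^ 2)
        ∂haarAddCircle =
      ∫⁻ r in Set.Ioo (0 : ℝ) 1, ∑ k ∈ Finset.range N,
        ENNReal.ofReal (((k : ℝ) + 1) ^ 2 * ‖y k‖ ^ 2) *
          ENNReal.ofReal (r ^ (2 * k + 1) * (1 - r ^ 2)) := by
    refine setLIntegral_congr_fun measurableSet_Ioo fun r hr => ?_
    have hr2 : 0 ≤ 1 - r ^ 2 := sub_nonneg.2 (pow_le_one₀ hr.1.le hr.2.le)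
    simp_rw [norm_coe_mul_toCircle hr.1.le]
    rw [lintegral_mul_const' _ _ ENNReal.ofReal_ne_top, lintegral_circle_poly_sq,
      ← ENNReal.ofReal_mul (Finset.sum_nonneg fun k _ =>
        mul_nonneg (pow_nonneg hr.1.le _) (by positivity)),
      ← ENNReal.ofReal_mul hr.1.le, Finset.sum_mul, Finset.mul_sum,
      ENNReal.ofReal_sum_of_nonneg fun k _ => mul_nonneg hr.1.le (mul_nonneg
        (mul_nonneg (pow_nonneg hr.1.le _) (by positivity)) hr2)]
    refine Finset.sum_congr rfl fun k _ => ?_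
    rw [← ENNReal.ofReal_mul (by positivity), hn]
    congr 1
    ring
  rw [h1, lintegral_finsetSum _ fun k _ => by fun_prop]
  simp_rw [lintegral_const_mul' _ _ ENNReal.ofReal_ne_top, lintegral_Ioo_pow_mul]
  simp_rw [← ENNReal.ofReal_mul (show 0 ≤ ((_ : ℝ) + 1) ^ 2 * ‖_‖ ^ 2 by positivity)]
  rw [← ENNReal.ofReal_sum_of_nonneg fun k _ => by positivity,
    ← ENNReal.ofReal_mul (by positivity)]
  refine ENNReal.ofReal_le_ofReal ?_
  rw [mul_comm 2 Real.pi, mul_assoc]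
  gcongr
  rw [Finset.mul_sum]
  refine Finset.sum_le_sum fun k _ => ?_
  have : 2 * (((k : ℝ) + 1) ^ 2 * ‖y k‖ ^ 2 * (1 / (2 * ((k : ℝ) + 1) * ((k : ℝ) + 2)))) =
      ((k : ℝ) + 1) / ((k : ℝ) + 2) * ‖y k‖ ^ 2 := by
    field_simp
  rw [this]
  refine mul_le_of_le_one_left (by positivity) ?_
  rw [div_le_one (by positivity)]
  linarith

/-- Homogeneity extends the Carleson condition from unit functions to all polynomials; the zero
polynomial cannot be normalized and is treated apart. -/
lemma lintegral_disc_diffOp_poly_sq_le (φ : ℂ → (H →L[ℂ] H)) (N : ℕ) (x : ℕ → H) :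
    ∫⁻ z in disc, ‖(diffOp φ z) (poly N x ((starRingEnd ℂ) z))‖ₑ ^ 2 *
      ENNReal.ofReal (1 - ‖z‖ ^ 2) ≤
      normC φ ^ 2 * ENNReal.ofReal (∑ m ∈ Finset.range N, ‖x m‖ ^ 2) := by
  have hS0 : 0 ≤ ∑ m ∈ Finset.range N, ‖x m‖ ^ 2 := Finset.sum_nonneg fun _ _ => by positivity
  rcases hS0.eq_or_lt with h0 | hpos
  · have hx : ∀ m ∈ Finset.range N, x m = 0 := fun m hm => by
      have := (Finset.sum_eq_zero_iff_of_nonneg (fun _ _ => by positivity)).1 h0.symm m hm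
      simpa using this
    have hp : ∀ z, poly N x z = 0 := fun z =>
      Finset.sum_eq_zero fun m hm => by rw [hx m hm, smul_zero]
    simp [hp]
  set σ : ℝ := √(∑ m ∈ Finset.range N, ‖x m‖ ^ 2) with hσ
  have hσ0 : 0 < σ := Real.sqrt_pos.2 hpos
  have hσ2 : σ ^ 2 = ∑ m ∈ Finset.range N, ‖x m‖ ^ 2 := Real.sq_sqrt hS0
  set u : ℕ → H := fun m => (σ⁻¹ : ℂ) • x m with hu
  have hmem : poly N u ∈ unitHolLarger H := by
    refine ⟨isHolLarger_poly N u, ?_⟩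
    have h1 := hardyNorm_poly_sq N u
    have h2 : ∑ n ∈ Finset.range N, ‖u n‖ ^ 2 = 1 := by
      simp only [hu, norm_smul, mul_pow, ← Finset.mul_sum, ← hσ2]
      rw [norm_inv, Complex.norm_of_nonneg hσ0.le, inv_pow, inv_mul_cancel₀ (by positivity)]
    rw [h2, ENNReal.ofReal_one] at h1
    exact (ENNReal.pow_right_strictMono two_ne_zero).injective (h1.trans (one_pow 2).symm)
  have hpoly : ∀ z, poly N x z = (σ : ℂ) • poly N u z := fun z => by
    simp only [poly, Finset.smul_sum, hu]
    refine Finset.sum_congr rfl fun m _ => ?_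
    rw [smul_comm, smul_smul (σ : ℂ), mul_inv_cancel₀ (by exact_mod_cast hσ0.ne'), one_smul]
  have hC : normC φ ^ 2 = ⨆ f ∈ unitHolLarger H,
      ∫⁻ z in disc, ‖(diffOp φ z) (f ((starRingEnd ℂ) z))‖ₑ ^ 2 *
        ENNReal.ofReal (1 - ‖z‖ ^ 2) := by
    rw [normC, ← ENNReal.rpow_natCast, ← ENNReal.rpow_mul]
    norm_num
  rw [hC, ← hσ2, mul_comm]
  refine le_trans (le_of_eq ?_) (mul_le_mul_right (le_iSup₂ (f := fun (f : ℂ → H)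
    (_ : f ∈ unitHolLarger H) => ∫⁻ z in disc, ‖(diffOp φ z) (f ((starRingEnd ℂ) z))‖ₑ ^ 2 *
        ENNReal.ofReal (1 - ‖z‖ ^ 2)) _ hmem) _)
  rw [← lintegral_const_mul' _ _ ENNReal.ofReal_ne_top]
  refine lintegral_congr fun z => ?_
  rw [hpoly, map_smul, enorm_smul, mul_pow, enorm_sq_eq_ofReal (σ : ℂ),
    Complex.norm_of_nonneg hσ0.le, mul_assoc]

/-- The pairing of `Dφ(z) f(z̄)` with an analytic polynomial over a circle. -/
lemma integral_circle_inner {φ : ℂ → (H →L[ℂ] H)} (hφ : IsHol φ) {r : ℝ}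
    (hr : r ∈ Set.Ioo (0 : ℝ) 1) (N : ℕ) (y x : ℕ → H) :
    ∫ t : AddCircle (1 : ℝ), inner ℂ (poly N (fun k => ((k : ℂ) + 1) • y k)
        (r * (toCircle t : ℂ)))
      (diffOp φ (r * (toCircle t : ℂ)) (poly N x (starRingEnd ℂ (r * (toCircle t : ℂ)))))
      ∂haarAddCircle =
    ∑ k ∈ Finset.range N, ∑ m ∈ Finset.range N, ((r ^ (2 * (m + k)) : ℝ) : ℂ) *
      (((k : ℂ) + 1) * (((m + k : ℕ) : ℂ) + 1) * inner ℂ (y k) (taylorCoeff φ (m + k) (x m))) := by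
  have hcont : Continuous fun t : AddCircle (1 : ℝ) => diffOp φ (r * (toCircle t : ℂ)) :=
    (continuousOn_diffOp hφ).comp_continuous (by fun_prop) fun t =>
      mem_disc.2 ((norm_coe_mul_toCircle hr.1.le t).trans_lt hr.2)
  -- Evaluation as a continuous functional on operators lets the operator-valued integral of `Dφ` be
  -- computed first.
  set L : ℕ → ℕ → ((H →L[ℂ] H) →L[ℂ] ℂ) := fun k m =>
    (innerSL ℂ (y k)) ∘L (ContinuousLinearMap.apply ℂ H (x m)) with hL
  have hLa : ∀ k m A, L k m A = inner ℂ (y k) (A (x m)) := fun _ _ _ => rfl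
  -- Both arguments contribute powers of `z̄`: `z̄^k` from conjugate linearity of the inner product,
  -- `z̄^m` from `f(z̄)`. Their product has frequency `-(m + k)` and extracts the Hankel coefficient
  -- `m + k` of `Dφ`.
  have hpt : ∀ t : AddCircle (1 : ℝ), inner ℂ (poly N (fun k => ((k : ℂ) + 1) • y k)
        (r * (toCircle t : ℂ)))
      (diffOp φ (r * (toCircle t : ℂ)) (poly N x (starRingEnd ℂ (r * (toCircle t : ℂ))))) =
      ∑ k ∈ Finset.range N, ∑ m ∈ Finset.range N, (r : ℂ) ^ (m + k) * ((k : ℂ) + 1) *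
        L k m (fourier (-((m + k : ℕ) : ℤ)) t • diffOp φ (r * (toCircle t : ℂ))) := by
    intro t
    simp only [poly, map_sum, sum_inner, inner_sum, map_smul]
    rw [Finset.sum_comm]
    refine Finset.sum_congr rfl fun k _ => Finset.sum_congr rfl fun m _ => ?_
    rw [fourier_neg, ← coe_toCircle_pow]
    simp only [inner_smul_left, inner_smul_right, hLa, smul_eq_mul, map_mul, map_pow, map_add,
      Complex.conj_ofReal, map_natCast, map_one]
    ring
  simp_rw [hpt]
  have hint : ∀ k m : ℕ, Integrable (fun t : AddCircle (1 : ℝ) =>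
      fourier (-((m + k : ℕ) : ℤ)) t • diffOp φ (r * (toCircle t : ℂ))) haarAddCircle :=
    fun k m => Continuous.integrable_of_hasCompactSupport (by fun_prop)
      (HasCompactSupport.of_compactSpace _)
  rw [integral_finsetSum _ fun k _ => integrable_finsetSum _ fun m _ =>
    ((L k m).integrable_comp (hint k m)).const_mul _]
  refine Finset.sum_congr rfl fun k _ => ?_
  rw [integral_finsetSum _ fun m _ => ((L k m).integrable_comp (hint k m)).const_mul _]
  refine Finset.sum_congr rfl fun m _ => ?_
  rw [integral_const_mul, (L k m).integral_comp_comm (hint k m), integral_fourier_smul_diffOp hφ hr,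
    map_smul, map_smul, hLa]
  simp only [smul_eq_mul]
  push_cast
  ring

end Key
end VectorHankel

/-! ### The Carleson conditions bound the Hankel operator. -/

namespace VectorHankel
open MeasureTheory AddCircle Filter Topology

variable {H : Type*} [NormedAddCommGroup H] [InnerProductSpace ℂ H] [CompleteSpace H]

/-- The moment `1 / (2(m + k + 1)(m + k + 2))` cancels the factor `m + k + 1` coming from `Dφ`; the
factor `k + 1` from the test polynomial survives. -/
lemma integral_pow_smul_form (N : ℕ) (s : ℕ → ℕ → ℂ) :
    ∫ r in (0 : ℝ)..1, ((r * (1 - r ^ 2) : ℝ) : ℂ) * ∑ k ∈ Finset.range N, ∑ m ∈ Finset.range N,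
      ((r ^ (2 * (m + k)) : ℝ) : ℂ) * (((k : ℂ) + 1) * (((m + k : ℕ) : ℂ) + 1) * s k m) =
    (1 / 2) * ∑ k ∈ Finset.range N, ∑ m ∈ Finset.range N,
      ((((k : ℝ) + 1) / ((m : ℝ) + k + 2) : ℝ) : ℂ) * s k m := by
  simp_rw [Finset.mul_sum]
  rw [intervalIntegral.integral_finsetSum fun k _ =>
    Continuous.intervalIntegrable (by fun_prop) _ _]
  refine Finset.sum_congr rfl fun k _ => ?_
  rw [intervalIntegral.integral_finsetSum fun m _ =>
    Continuous.intervalIntegrable (by fun_prop) _ _]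
  refine Finset.sum_congr rfl fun m _ => ?_
  have : ∀ r : ℝ, ((r * (1 - r ^ 2) : ℝ) : ℂ) *
      (((r ^ (2 * (m + k)) : ℝ) : ℂ) * (((k : ℂ) + 1) * (((m + k : ℕ) : ℂ) + 1) * s k m)) =
      ((r ^ (2 * (m + k) + 1) * (1 - r ^ 2) : ℝ) : ℂ) *
        (((k : ℂ) + 1) * (((m + k : ℕ) : ℂ) + 1) * s k m) := fun r => by push_cast; ring
  simp_rw [this]
  rw [intervalIntegral.integral_mul_const, intervalIntegral.integral_ofReal,
    integral_pow_mul_one_sub_sq]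
  push_cast
  have h1 : (m : ℂ) + k + 1 ≠ 0 := by exact_mod_cast (m + k).succ_ne_zero
  have h2 : (m : ℂ) + k + 2 ≠ 0 := by exact_mod_cast (m + k + 1).succ_ne_zero
  field_simp

/-- The anti-analytic Carleson embedding controls the weighted Hankel form with weights
`(k + 1) / (m + k + 2)`. -/
lemma hankelFormBound_of_normC {φ : ℂ → (H →L[ℂ] H)} (hφ : IsHol φ) (hC : normC φ < ∞) :
    HankelFormBound (fun k m => ((k : ℝ) + 1) / ((m : ℝ) + k + 2)) (taylorCoeff φ)
      (normC φ).toReal := by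
  intro N y x
  set S : ℂ := ∑ k ∈ Finset.range N, ∑ m ∈ Finset.range N,
    ((((k : ℝ) + 1) / ((m : ℝ) + k + 2) : ℝ) : ℂ) * inner ℂ (y k) (taylorCoeff φ (m + k) (x m))
    with hS
  set p : ℂ → H := poly N (fun k => ((k : ℂ) + 1) • y k) with hp
  set g : ℂ → H := fun z => diffOp φ z (poly N x (starRingEnd ℂ z)) with hg
  have hpc : Continuous p := continuous_poly _ _
  have hgc : ContinuousOn g disc := (continuousOn_diffOp hφ).clm_apply
    ((continuous_poly N x).comp Complex.continuous_conj).continuousOn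
  have hdm : MeasurableSet disc := isOpen_disc.measurableSet
  have hgm : AEMeasurable (fun z => ‖g z‖ₑ ^ 2 * ENNReal.ofReal (1 - ‖z‖ ^ 2))
      (volume.restrict disc) :=
    (hgc.enorm.aemeasurable hdm).pow_const 2 |>.mul (by fun_prop)
  have hpm : AEMeasurable (fun z => ‖p z‖ₑ ^ 2 * ENNReal.ofReal (1 - ‖z‖ ^ 2))
      (volume.restrict disc) :=
    (hpc.enorm.measurable.pow_const 2 |>.mul (by fun_prop)).aemeasurable
  set F : ℂ → ℝ≥0∞ := fun z => ‖p z‖ₑ * ‖g z‖ₑ * ENNReal.ofReal (1 - ‖z‖ ^ 2) with hF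
  -- Off the disc `φ` is arbitrary, so measurability holds only after cutting off.
  have hFm : Measurable (disc.indicator F) := by
    classical
    have h0 : Measurable (disc.indicator fun z => ‖g z‖ₑ) := by
      rw [← Set.piecewise_eq_indicator]
      exact hgc.enorm.measurable_piecewise continuousOn_const hdm
    have h1 : disc.indicator F = fun z =>
        ‖p z‖ₑ * disc.indicator (fun z => ‖g z‖ₑ) z * ENNReal.ofReal (1 - ‖z‖ ^ 2) := by
      ext z
      by_cases hz : z ∈ disc <;> simp [hz, hF]
    rw [h1]
    exact (hpc.enorm.measurable.mul h0).mul (by fun_prop)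
  have hlow : ENNReal.ofReal (2 * Real.pi) * ‖(1 / 2) * S‖ₑ ≤ ∫⁻ z in disc, F z := by
    rw [← setLIntegral_congr_fun hdm (f := disc.indicator F)
      fun z hz => Set.indicator_of_mem hz F, lintegral_disc_polar hFm]
    gcongr
    rw [← integral_pow_smul_form, intervalIntegral.integral_of_le zero_le_one,
      integral_Ioc_eq_integral_Ioo]
    refine (enorm_integral_le_lintegral_enorm _).trans ?_
    refine setLIntegral_mono' measurableSet_Ioo fun r hr => ?_
    have hr2 : 0 ≤ 1 - r ^ 2 := sub_nonneg.2 (pow_le_one₀ hr.1.le hr.2.le)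
    rw [← integral_circle_inner hφ hr, enorm_mul, Complex.ofReal_mul, enorm_mul, mul_assoc,
      ← ofReal_norm (r : ℂ), Complex.norm_of_nonneg hr.1.le, ← ofReal_norm ((1 - r ^ 2 : ℝ) : ℂ),
      Complex.norm_of_nonneg hr2]
    gcongr
    rw [mul_comm]
    refine (mul_le_mul_left (enorm_integral_le_lintegral_enorm _) _).trans ?_
    rw [← lintegral_mul_const' _ _ ENNReal.ofReal_ne_top]
    refine lintegral_mono fun t => ?_
    have ht := norm_coe_mul_toCircle hr.1.le t
    rw [Set.indicator_of_mem (mem_disc.2 (ht.trans_lt hr.2))]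
    simp only [hF, ht]
    gcongr
    rw [← ofReal_norm, ← ofReal_norm, ← ofReal_norm, ← ENNReal.ofReal_mul (norm_nonneg _)]
    exact ENNReal.ofReal_le_ofReal (norm_inner_le_norm _ _)
  have hCS : ∫⁻ z in disc, F z ≤
      (ENNReal.ofReal (Real.pi * ∑ k ∈ Finset.range N, ‖y k‖ ^ 2)) ^ (1 / 2 : ℝ) *
      (normC φ ^ 2 * ENNReal.ofReal (∑ m ∈ Finset.range N, ‖x m‖ ^ 2)) ^ (1 / 2 : ℝ) := by
    have h1 := ENNReal.lintegral_mul_norm_pow_le hpm hgm (p := 1 / 2) (q := 1 / 2)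
      (by norm_num) (by norm_num) (by norm_num)
    refine le_trans (le_of_eq ?_) (h1.trans ?_)
    · refine lintegral_congr fun z => ?_
      rw [← ENNReal.mul_rpow_of_nonneg _ _ (by norm_num)]
      have : ‖p z‖ₑ ^ 2 * ENNReal.ofReal (1 - ‖z‖ ^ 2) *
          (‖g z‖ₑ ^ 2 * ENNReal.ofReal (1 - ‖z‖ ^ 2)) = F z ^ 2 := by
        simp only [hF]; ring
      rw [this, ← ENNReal.rpow_natCast, ← ENNReal.rpow_mul]
      norm_num
    · gcongr
      · exact lintegral_disc_poly_sq_le N y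
      · exact lintegral_disc_diffOp_poly_sq_le φ N x
  have hfin := hlow.trans hCS
  have hy0 : 0 ≤ ∑ k ∈ Finset.range N, ‖y k‖ ^ 2 := Finset.sum_nonneg fun _ _ => by positivity
  have hx0 : 0 ≤ ∑ k ∈ Finset.range N, ‖x k‖ ^ 2 := Finset.sum_nonneg fun _ _ => by positivity
  set c := (normC φ).toReal with hc
  have hc0 : 0 ≤ c := ENNReal.toReal_nonneg
  have hcn : normC φ = ENNReal.ofReal c := (ENNReal.ofReal_toReal hC.ne).symm
  rw [hcn, ← ENNReal.ofReal_pow hc0, ← ENNReal.ofReal_mul (by positivity),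
    ENNReal.ofReal_rpow_of_nonneg (by positivity) (by norm_num),
    ENNReal.ofReal_rpow_of_nonneg (by positivity) (by norm_num),
    ← ENNReal.ofReal_mul (by positivity), ← ofReal_norm, ← ENNReal.ofReal_mul (by positivity),
    ENNReal.ofReal_le_ofReal_iff (by positivity), ← Real.sqrt_eq_rpow, ← Real.sqrt_eq_rpow,
    Real.sqrt_mul Real.pi_pos.le, Real.sqrt_mul (by positivity), Real.sqrt_sq hc0, norm_mul] at hfin
  norm_num at hfin
  set Y := √(∑ k ∈ Finset.range N, ‖y k‖ ^ 2)
  set X := √(∑ k ∈ Finset.range N, ‖x k‖ ^ 2)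
  -- The argument yields the constant `1/√π`; relaxing it to 1 is enough.
  have hpi : √Real.pi ≤ Real.pi := by
    rw [Real.sqrt_le_left Real.pi_pos.le]
    nlinarith [Real.pi_gt_three]
  have h2 : Real.pi * ‖S‖ ≤ Real.pi * (c * (Y * X)) := by
    calc Real.pi * ‖S‖ = 2 * Real.pi * (1 / 2 * ‖S‖) := by ring
      _ ≤ √Real.pi * Y * (c * X) := by simpa using hfin
      _ ≤ Real.pi * Y * (c * X) := by gcongr
      _ = _ := by ring
  exact le_of_mul_le_mul_left h2 Real.pi_pos

lemma isHol_of_hasSum {E : Type*} [NormedAddCommGroup E] [NormedSpace ℂ E] [CompleteSpace E]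
    {f : ℂ → E} {a : ℕ → E} (ha : ∀ r ∈ Set.Ioo (0 : ℝ) 1, Summable fun n => ‖a n‖ * r ^ n)
    (hf : ∀ z : ℂ, ‖z‖ < 1 → HasSum (fun n => z ^ n • a n) (f z)) : IsHol f := by
  intro z hz
  obtain ⟨r, hzr, hr1⟩ := exists_between (mem_disc.1 hz)
  have hr : r ∈ Set.Ioo (0 : ℝ) 1 := ⟨(norm_nonneg z).trans_lt hzr, hr1⟩
  have hd : DifferentiableOn ℂ (fun w : ℂ => ∑' n, w ^ n • a n) (Metric.ball 0 r) := by
    refine Complex.differentiableOn_tsum_of_summable_norm (ha r hr)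
      (fun n => Differentiable.differentiableOn (by fun_prop)) Metric.isOpen_ball fun n w hw => ?_
    rw [norm_smul, norm_pow, mul_comm]
    gcongr
    exact (mem_ball_zero_iff.1 hw).le
  have hmem : Metric.ball (0 : ℂ) r ∈ 𝓝 z := Metric.isOpen_ball.mem_nhds (by simpa using hzr)
  refine DifferentiableAt.differentiableWithinAt
    ((hd.differentiableAt hmem).congr_of_eventuallyEq ?_)
  filter_upwards [hmem] with w hw
  exact (hf w ((mem_ball_zero_iff.1 hw).trans hr1)).tsum_eq.symm

/-- Both coefficient sequences are recovered from the same integral of `f` over the circle of radius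
`1/2`. -/
lemma taylorCoeff_eq_of_hasSum {E : Type*} [NormedAddCommGroup E] [NormedSpace ℂ E]
    [CompleteSpace E] {f : ℂ → E} {a : ℕ → E}
    (ha : ∀ r ∈ Set.Ioo (0 : ℝ) 1, Summable fun n => ‖a n‖ * r ^ n)
    (hf : ∀ z : ℂ, ‖z‖ < 1 → HasSum (fun n => z ^ n • a n) (f z)) (n : ℕ) :
    taylorCoeff f n = a n := by
  have hr : (1 / 2 : ℝ) ∈ Set.Ioo (0 : ℝ) 1 := by norm_num
  have key : ∀ b : ℕ → E, (∀ r ∈ Set.Ioo (0 : ℝ) 1, Summable fun n => ‖b n‖ * r ^ n) →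
      (∀ z : ℂ, ‖z‖ < 1 → HasSum (fun n => z ^ n • b n) (f z)) →
      ∫ t : AddCircle (1 : ℝ), fourier (-(n : ℤ)) t • f (((1 / 2 : ℝ) : ℂ) * (toCircle t : ℂ))
        ∂haarAddCircle = (((1 / 2 : ℝ) : ℂ)) ^ n • b n := by
    intro b hb hfb
    have hs : Summable fun n => ‖(((1 / 2 : ℝ) : ℂ)) ^ n • b n‖ := by
      refine (hb _ hr).congr fun n => ?_
      rw [norm_smul, norm_pow, Complex.norm_of_nonneg hr.1.le, mul_comm]
    rw [← integral_fourier_smul_tsum hs n]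
    refine integral_congr_ae (.of_forall fun t => ?_)
    dsimp only
    congr 1
    rw [← (hfb _ ((norm_coe_mul_toCircle hr.1.le t).trans_lt hr.2)).tsum_eq]
    refine tsum_congr fun n => ?_
    rw [mul_pow, coe_toCircle_pow, mul_comm, mul_smul]
  have hd := isHol_of_hasSum ha hf
  have h := (key _ (fun r hr => summable_norm_taylorCoeff hd hr.1.le hr.2)
    fun z hz => hasSum_taylorCoeff hd hz).symm.trans (key a ha hf)
  exact smul_right_injective E (pow_ne_zero n (by norm_num)) h

lemma hasSum_sharp {φ : ℂ → (H →L[ℂ] H)} (hφ : IsHol φ) {z : ℂ} (hz : ‖z‖ < 1) :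
    HasSum (fun n => z ^ n • ContinuousLinearMap.adjoint (taylorCoeff φ n)) (sharp φ z) := by
  have h := hasSum_taylorCoeff hφ (z := starRingEnd ℂ z) (by simpa using hz)
  have h2 := h.map (ContinuousLinearMap.adjoint (𝕜 := ℂ) (E := H) (F := H))
    (ContinuousLinearMap.adjoint (𝕜 := ℂ) (E := H) (F := H)).continuous
  refine h2.congr_fun fun n => ?_
  rw [Function.comp_apply, map_smulₛₗ, map_pow, Complex.conj_conj]

lemma summable_norm_adjoint_taylorCoeff {φ : ℂ → (H →L[ℂ] H)} (hφ : IsHol φ) {r : ℝ}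
    (hr : r ∈ Set.Ioo (0 : ℝ) 1) :
    Summable fun n => ‖ContinuousLinearMap.adjoint (taylorCoeff φ n)‖ * r ^ n := by
  simpa using summable_norm_taylorCoeff hφ hr.1.le hr.2

lemma isHol_sharp {φ : ℂ → (H →L[ℂ] H)} (hφ : IsHol φ) : IsHol (sharp φ) :=
  isHol_of_hasSum (fun _ hr => summable_norm_adjoint_taylorCoeff hφ hr) fun _ hz =>
    hasSum_sharp hφ hz

lemma taylorCoeff_sharp {φ : ℂ → (H →L[ℂ] H)} (hφ : IsHol φ) (n : ℕ) :
    taylorCoeff (sharp φ) n = ContinuousLinearMap.adjoint (taylorCoeff φ n) :=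
  taylorCoeff_eq_of_hasSum (fun _ hr => summable_norm_adjoint_taylorCoeff hφ hr)
    (fun _ hz => hasSum_sharp hφ hz) n

/-- The coefficients of `φ^#` are the adjoints, so conjugating its form exchanges the roles of `x`
and `y` and transposes the weight. -/
lemma hankelFormBound_of_normC_sharp {φ : ℂ → (H →L[ℂ] H)} (hφ : IsHol φ)
    (hC : normC (sharp φ) < ∞) :
    HankelFormBound (fun k m => ((m : ℝ) + 1) / ((m : ℝ) + k + 2)) (taylorCoeff φ)
      (normC (sharp φ)).toReal := by
  intro N y x
  have h := hankelFormBound_of_normC (isHol_sharp hφ) hC N x y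
  rw [mul_comm √_]
  refine le_trans (le_of_eq ?_) h
  rw [← Complex.norm_conj, map_sum, Finset.sum_congr rfl fun k _ => map_sum _ _ _,
    Finset.sum_comm]
  congr 1
  refine Finset.sum_congr rfl fun m _ => Finset.sum_congr rfl fun k _ => ?_
  rw [map_mul, inner_conj_symm, taylorCoeff_sharp hφ, ContinuousLinearMap.adjoint_inner_right,
    Complex.conj_ofReal, add_comm k m]
  dsimp only
  rw [add_comm (k : ℝ) m]

/-- The weight and its transpose add up to one. -/
lemma hankelFormBound_one {φ : ℂ → (H →L[ℂ] H)} (hφ : IsHol φ) (hC : normC φ < ∞)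
    (hC' : normC (sharp φ) < ∞) :
    HankelFormBound (fun _ _ => 1) (taylorCoeff φ)
      ((normC φ).toReal + (normC (sharp φ)).toReal) := by
  intro N y x
  have h1 := hankelFormBound_of_normC hφ hC N y x
  have h2 := hankelFormBound_of_normC_sharp hφ hC' N y x
  rw [add_mul]
  refine le_trans ?_ (add_le_add h1 h2)
  refine le_trans (le_of_eq ?_) (norm_add_le _ _)
  rw [← Finset.sum_add_distrib]
  congr 1
  refine Finset.sum_congr rfl fun k _ => ?_
  rw [← Finset.sum_add_distrib]
  refine Finset.sum_congr rfl fun m _ => ?_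
  rw [← add_mul, ← Complex.ofReal_add]
  congr 2
  have : (m : ℝ) + k + 2 ≠ 0 := by positivity
  field_simp
  ring

theorem normNP_le {φ : ℂ → (H →L[ℂ] H)} (hφ : IsHol φ) (hC : normC φ < ∞)
    (hC' : normC (sharp φ) < ∞) : normNP φ ≤ normC φ + normC (sharp φ) := by
  have h := normNP_le_of_hankelFormBound hφ (by positivity) (hankelFormBound_one hφ hC hC')
  rwa [ENNReal.ofReal_add (by positivity) (by positivity), ENNReal.ofReal_toReal hC.ne,
    ENNReal.ofReal_toReal hC'.ne] at h

end VectorHankel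

/-! ### Hilbert's inequality and a bounded Hankel form built from it. -/

namespace VectorHankel
open MeasureTheory AddCircle Filter Topology

lemma norm_periodizedBernoulli_one_le (t : UnitAddCircle) :
    ‖(periodizedBernoulli 1 t : ℂ)‖ ≤ 1 := by
  have h : periodizedBernoulli 1 t = bernoulliFun 1 (AddCircle.equivIco 1 0 t : ℝ) := rfl
  have h2 := (AddCircle.equivIco 1 0 t).2
  rw [h, bernoulliFun_one, Complex.norm_real, Real.norm_eq_abs, abs_le]
  simp only [Set.mem_Ico, zero_add] at h2
  constructor <;> linarith [h2.1, h2.2]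

/-- At `n = 0` the convention `0⁻¹ = 0` agrees with the vanishing mean of the sawtooth; this matches
the zero diagonal of Hilbert's matrix. -/
lemma fourierCoeff_periodizedBernoulli_one (n : ℤ) :
    fourierCoeff (fun t : UnitAddCircle => (periodizedBernoulli 1 t : ℂ)) n =
      -(2 * Real.pi * Complex.I)⁻¹ * (n : ℂ)⁻¹ := by
  have := fourierCoeff_bernoulli_eq one_ne_zero n
  simp only [Function.comp_def, Nat.factorial_one, Nat.cast_one, pow_one] at this
  rw [this, neg_div, one_div, mul_inv, neg_mul]

lemma integrable_periodizedBernoulli_one :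
    Integrable (fun t : UnitAddCircle => (periodizedBernoulli 1 t : ℂ)) haarAddCircle := by
  have h1 : Integrable (fun t : UnitAddCircle => fourier (-1) t • (periodizedBernoulli 1 t : ℂ))
      haarAddCircle := by
    -- A non-integrable integrand would have integral 0 by convention, yet the first Fourier
    -- coefficient is nonzero.
    by_contra h
    have h2 := fourierCoeff_periodizedBernoulli_one 1
    rw [fourierCoeff, integral_undef h] at h2
    simp [Real.pi_ne_zero] at h2
  have h2 := h1.bdd_mul (f := fun t => fourier 1 t) (c := 1)
    (Continuous.aestronglyMeasurable (by fun_prop))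
    (.of_forall fun t => (norm_fourier_apply 1 t).le)
  refine h2.congr (.of_forall fun t => ?_)
  dsimp only
  rw [smul_eq_mul, ← mul_assoc, ← fourier_add]
  simp

/-- Hilbert's inequality for the antisymmetric matrix `(a - b)⁻¹`. -/
lemma norm_sum_inv_sub_mul_le (N : ℕ) (u v : ℕ → ℂ) :
    ‖∑ a ∈ Finset.range N, ∑ b ∈ Finset.range N, ((((a : ℝ) - b)⁻¹ : ℝ) : ℂ) * (u a * v b)‖ ≤
      2 * Real.pi * (√(∑ a ∈ Finset.range N, ‖u a‖ ^ 2) * √(∑ b ∈ Finset.range N, ‖v b‖ ^ 2)) := by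
  -- The matrix is, up to the factor `-(2πi)⁻¹`, a Toeplitz matrix with bounded symbol, the
  -- sawtooth. Conjugating `u` in `p` makes `p̄ q` produce the products `u a * v b`.
  set g : UnitAddCircle → ℂ := fun t => (periodizedBernoulli 1 t : ℂ) with hg
  set p : UnitAddCircle → ℂ := fun t =>
    poly N (fun a => starRingEnd ℂ (u a)) (((1 : ℝ) : ℂ) * (toCircle t : ℂ)) with hp
  set q : UnitAddCircle → ℂ := fun t => poly N v (((1 : ℝ) : ℂ) * (toCircle t : ℂ)) with hq
  have hpc : Continuous p := (continuous_poly _ _).comp (by fun_prop)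
  have hqc : Continuous q := (continuous_poly _ _).comp (by fun_prop)
  have hgi : Integrable g haarAddCircle := integrable_periodizedBernoulli_one
  have hterm : ∀ n : ℤ, Integrable (fun t => fourier n t • g t) haarAddCircle := fun n =>
    hgi.fourier_smul n
  have hint : ∫ t, g t * (starRingEnd ℂ (p t) * q t) ∂haarAddCircle =
      -(2 * Real.pi * Complex.I)⁻¹ * ∑ a ∈ Finset.range N, ∑ b ∈ Finset.range N,
        ((((a : ℝ) - b)⁻¹ : ℝ) : ℂ) * (u a * v b) := by
    have hpt : ∀ t, g t * (starRingEnd ℂ (p t) * q t) = ∑ a ∈ Finset.range N,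
        ∑ b ∈ Finset.range N, (fourier (-((a : ℤ) - b)) t • g t) * (u a * v b) := by
      intro t
      simp only [hp, hq, poly, map_sum]
      rw [Finset.sum_mul_sum, Finset.mul_sum]
      simp_rw [Finset.mul_sum]
      refine Finset.sum_congr rfl fun a _ => Finset.sum_congr rfl fun b _ => ?_
      rw [show -((a : ℤ) - b) = -(a : ℤ) + b by ring, fourier_add, fourier_neg,
        ← coe_toCircle_pow, ← coe_toCircle_pow]
      simp only [smul_eq_mul, map_mul, map_pow, Complex.conj_conj, Complex.ofReal_one, one_mul]
      ring
    simp_rw [hpt]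
    rw [integral_finsetSum _ fun a _ => integrable_finsetSum _ fun b _ => (hterm _).mul_const _,
      Finset.mul_sum]
    refine Finset.sum_congr rfl fun a _ => ?_
    rw [integral_finsetSum _ fun b _ => (hterm _).mul_const _, Finset.mul_sum]
    refine Finset.sum_congr rfl fun b _ => ?_
    rw [integral_mul_const]
    have h := fourierCoeff_periodizedBernoulli_one ((a : ℤ) - b)
    rw [fourierCoeff] at h
    rw [h]
    push_cast
    ring
  have h1 : ‖∫ t, g t * (starRingEnd ℂ (p t) * q t) ∂haarAddCircle‖ₑ ≤
      ∫⁻ t, (‖p t‖ₑ ^ 2) ^ (1 / 2 : ℝ) * (‖q t‖ₑ ^ 2) ^ (1 / 2 : ℝ) ∂haarAddCircle := by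
    refine (enorm_integral_le_lintegral_enorm _).trans (lintegral_mono fun t => ?_)
    have hs : ∀ c : ℝ≥0∞, (c ^ 2) ^ (1 / 2 : ℝ) = c := fun c => by
      rw [← ENNReal.rpow_natCast, ← ENNReal.rpow_mul]; norm_num
    rw [hs, hs, enorm_mul, enorm_mul, RCLike.enorm_conj]
    refine mul_le_of_le_one_left (by simp) ?_
    rw [← ofReal_norm, ENNReal.ofReal_le_one]
    exact norm_periodizedBernoulli_one_le t
  have h2 := h1.trans (ENNReal.lintegral_mul_norm_pow_le
    (hpc.enorm.measurable.pow_const 2).aemeasurable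
    (hqc.enorm.measurable.pow_const 2).aemeasurable (p := 1 / 2) (q := 1 / 2)
    (by norm_num) (by norm_num) (by norm_num))
  rw [lintegral_circle_poly_sq, lintegral_circle_poly_sq, hint,
    ENNReal.ofReal_rpow_of_nonneg (Finset.sum_nonneg fun _ _ => by positivity) (by norm_num),
    ENNReal.ofReal_rpow_of_nonneg (Finset.sum_nonneg fun _ _ => by positivity) (by norm_num),
    ← ENNReal.ofReal_mul (by positivity), ← ofReal_norm,
    ENNReal.ofReal_le_ofReal_iff (by positivity), ← Real.sqrt_eq_rpow, ← Real.sqrt_eq_rpow,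
    norm_mul] at h2
  simp only [one_pow, one_mul, RCLike.norm_conj] at h2
  have h3 : ‖-(2 * (Real.pi : ℂ) * Complex.I)⁻¹‖ = (2 * Real.pi)⁻¹ := by
    simp [abs_of_pos Real.pi_pos]
  rw [h3, inv_mul_le_iff₀ (by positivity)] at h2
  exact h2

/-- By injectivity each inner sum has at most one active term, and each `k` is active for at most
one `s`. -/
lemma sum_norm_sq_sum_ite_le {E ι κ : Type*} [SeminormedAddCommGroup E] [DecidableEq κ]
    (S : Finset κ) (K : Finset ι) {f : ι → κ} (hf : Set.InjOn f K) (z : ι → E) :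
    ∑ s ∈ S, ‖∑ k ∈ K, if f k = s then z k else 0‖ ^ 2 ≤ ∑ k ∈ K, ‖z k‖ ^ 2 := by
  have h : ∀ s, ‖∑ k ∈ K, if f k = s then z k else 0‖ ^ 2 =
      ∑ k ∈ K, if f k = s then ‖z k‖ ^ 2 else 0 := by
    intro s
    by_cases hs : ∃ k ∈ K, f k = s
    · obtain ⟨k, hk, rfl⟩ := hs
      have hne : ∀ j ∈ K, j ≠ k → f j ≠ f k := fun j hj hjk h => hjk (hf hj hk h)
      rw [Finset.sum_eq_single_of_mem k hk fun j hj hjk => if_neg (hne j hj hjk),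
        Finset.sum_eq_single_of_mem k hk fun j hj hjk => if_neg (hne j hj hjk), if_pos rfl,
        if_pos rfl]
    · push Not at hs
      rw [Finset.sum_eq_zero fun k hk => if_neg (hs k hk),
        Finset.sum_eq_zero fun k hk => if_neg (hs k hk)]
      simp
  simp_rw [h]
  rw [Finset.sum_comm]
  refine Finset.sum_le_sum fun k _ => ?_
  rw [Finset.sum_ite_eq]
  split_ifs
  · exact le_rfl
  · positivity

section Counterexample
variable {H : Type*} [NormedAddCommGroup H] [InnerProductSpace ℂ H]

/-- The coefficients `∑_{2^a + 2^b = n} (a - b)⁻¹ ⟨e b, ·⟩ e a`. -/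
noncomputable def hilbertCoeff (e : ℕ → H) (n : ℕ) : H →L[ℂ] H :=
  ∑ a ∈ Finset.range (n + 1), ∑ b ∈ Finset.range (n + 1),
    if 2 ^ a + 2 ^ b = n then
      ((((a : ℝ) - b)⁻¹ : ℝ) : ℂ) • (innerSL ℂ (e b)).smulRight (e a) else 0

lemma inner_hilbertCoeff (e : ℕ → H) {n M : ℕ} (hM : n + 1 ≤ M) (y x : H) :
    inner ℂ y (hilbertCoeff e n x) = ∑ a ∈ Finset.range M, ∑ b ∈ Finset.range M,
      if 2 ^ a + 2 ^ b = n then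
        ((((a : ℝ) - b)⁻¹ : ℝ) : ℂ) * (inner ℂ y (e a) * inner ℂ (e b) x) else 0 := by
  have hlt : ∀ a b : ℕ, 2 ^ a + 2 ^ b = n → a < n + 1 ∧ b < n + 1 := fun a b h => by
    have h1 := a.lt_two_pow_self
    have h2 := b.lt_two_pow_self
    omega
  have hsub : Finset.range (n + 1) ⊆ Finset.range M := Finset.range_subset_range.2 hM
  rw [hilbertCoeff, sum_apply, inner_sum]
  rw [← Finset.sum_subset hsub]
  · refine Finset.sum_congr rfl fun a _ => ?_
    rw [sum_apply, inner_sum, ← Finset.sum_subset hsub]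
    · refine Finset.sum_congr rfl fun b _ => ?_
      split_ifs
      · simp only [smul_apply, ContinuousLinearMap.smulRight_apply,
          innerSL_apply_apply, inner_smul_right]
        ring
      · simp
    · intro b _ hb
      exact if_neg fun h => hb (Finset.mem_range.2 (hlt a b h).2)
  · intro a _ ha
    exact Finset.sum_eq_zero fun b _ => if_neg fun h => ha (Finset.mem_range.2 (hlt a b h).1)

lemma abs_inv_sub_le_one (a b : ℕ) : |((a : ℝ) - b)⁻¹| ≤ 1 := by
  rcases eq_or_ne a b with rfl | hab
  · simp
  · rw [abs_inv]
    refine inv_le_one_of_one_le₀ ?_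
    have : (1 : ℤ) ≤ |(a : ℤ) - b| := Int.one_le_abs (by omega)
    exact_mod_cast this

/-- Counting terms is crude, but polynomial growth suffices for convergence on the unit disc. -/
lemma norm_hilbertCoeff_le {e : ℕ → H} (he : Orthonormal ℂ e) (n : ℕ) :
    ‖hilbertCoeff e n‖ ≤ ((n : ℝ) + 1) ^ 2 := by
  have h : ∀ a b : ℕ, ‖if 2 ^ a + 2 ^ b = n then
      ((((a : ℝ) - b)⁻¹ : ℝ) : ℂ) • (innerSL ℂ (e b)).smulRight (e a) else 0‖ ≤ 1 := by
    intro a b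
    split_ifs
    · rw [norm_smul, ContinuousLinearMap.norm_smulRight_apply, innerSL_apply_norm, he.1, he.1,
        Complex.norm_real, mul_one, mul_one]
      exact abs_inv_sub_le_one a b
    · simp
  refine (norm_sum_le _ _).trans ((Finset.sum_le_sum fun a _ => (norm_sum_le _ _).trans
    (Finset.sum_le_sum fun b _ => h a b)).trans (le_of_eq ?_))
  simp
  ring

lemma summable_norm_hilbertCoeff {e : ℕ → H} (he : Orthonormal ℂ e) {r : ℝ}
    (hr : r ∈ Set.Ioo (0 : ℝ) 1) : Summable fun n => ‖hilbertCoeff e n‖ * r ^ n := by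
  have hn : ‖r‖ < 1 := by rw [Real.norm_of_nonneg hr.1.le]; exact hr.2
  have h2 := summable_pow_mul_geometric_of_norm_lt_one 2 hn
  have h1 := summable_pow_mul_geometric_of_norm_lt_one 1 hn
  have h0 := summable_geometric_of_norm_lt_one hn
  refine Summable.of_nonneg_of_le (fun n => mul_nonneg (norm_nonneg _) (pow_nonneg hr.1.le n))
    (fun n => ?_) ((h2.add (h1.mul_left 2)).add h0)
  refine (mul_le_mul_of_nonneg_right (norm_hilbertCoeff_le he n)
    (pow_nonneg hr.1.le n)).trans (le_of_eq ?_)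
  ring

/-- The Hankel form with coefficients `hilbertCoeff e` is bounded. -/
lemma hankelFormBound_hilbertCoeff {e : ℕ → H} (he : Orthonormal ℂ e) :
    HankelFormBound (fun _ _ => 1) (hilbertCoeff e) (2 * Real.pi) := by
  intro N y x
  -- Large enough that `m + k + 1 ≤ M` for all `m, k < N`.
  set M := 2 * N + 1 with hM
  set α : ℕ → ℕ → ℂ := fun k a => inner ℂ (y k) (e a) with hα
  set β : ℕ → ℕ → ℂ := fun m b => inner ℂ (e b) (x m) with hβ
  -- The constraint `2^a + 2^b = m + k` reads `2^a - k = m - 2^b`. Fixing the common value `s`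
  -- separates `(k, a)` from `(m, b)` and leaves one scalar Hilbert form for each `s`.
  set S : Finset ℤ := (Finset.range N ×ˢ Finset.range M).image
    fun p => (2 : ℤ) ^ p.2 - p.1 with hS
  set U : ℤ → ℕ → ℂ := fun s a => ∑ k ∈ Finset.range N,
    if (2 : ℤ) ^ a - k = s then α k a else 0 with hU
  set V : ℤ → ℕ → ℂ := fun s b => ∑ m ∈ Finset.range N,
    if (m : ℤ) - 2 ^ b = s then β m b else 0 with hV
  have hsum : ∑ k ∈ Finset.range N, ∑ m ∈ Finset.range N,
      ((1 : ℝ) : ℂ) * inner ℂ (y k) (hilbertCoeff e (m + k) (x m)) =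
      ∑ s ∈ S, ∑ a ∈ Finset.range M, ∑ b ∈ Finset.range M,
        ((((a : ℝ) - b)⁻¹ : ℝ) : ℂ) * (U s a * V s b) := by
    calc _ = ∑ k ∈ Finset.range N, ∑ m ∈ Finset.range N, ∑ a ∈ Finset.range M,
          ∑ b ∈ Finset.range M, ∑ s ∈ S, ((((a : ℝ) - b)⁻¹ : ℝ) : ℂ) *
            ((if (2 : ℤ) ^ a - k = s then α k a else 0) *
              (if (m : ℤ) - 2 ^ b = s then β m b else 0)) := by
          refine Finset.sum_congr rfl fun k hk => Finset.sum_congr rfl fun m hm => ?_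
          rw [Finset.mem_range] at hk hm
          rw [Complex.ofReal_one, one_mul, inner_hilbertCoeff e (M := M) (by omega)]
          refine Finset.sum_congr rfl fun a ha => Finset.sum_congr rfl fun b hb => ?_
          have hmem : (2 : ℤ) ^ a - k ∈ S := Finset.mem_image.2
            ⟨(k, a), Finset.mem_product.2 ⟨Finset.mem_range.2 hk, ha⟩, rfl⟩
          rw [Finset.sum_eq_single_of_mem _ hmem fun s _ hs => by rw [if_neg (Ne.symm hs)]; simp]
          rw [if_pos rfl]
          have hiff : 2 ^ a + 2 ^ b = m + k ↔ (m : ℤ) - 2 ^ b = 2 ^ a - k := by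
            rw [← Nat.cast_inj (R := ℤ)]
            push_cast
            constructor <;> intro h <;> linarith
          by_cases h : 2 ^ a + 2 ^ b = m + k
          · rw [if_pos h, if_pos (hiff.1 h)]
          · rw [if_neg h, if_neg (mt hiff.2 h)]; simp
      _ = ∑ s ∈ S, ∑ a ∈ Finset.range M, ∑ b ∈ Finset.range M, ∑ k ∈ Finset.range N,
            ∑ m ∈ Finset.range N, ((((a : ℝ) - b)⁻¹ : ℝ) : ℂ) *
            ((if (2 : ℤ) ^ a - k = s then α k a else 0) *
              (if (m : ℤ) - 2 ^ b = s then β m b else 0)) := by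
          simp_rw [Finset.sum_comm (t := S)]
          refine Finset.sum_congr rfl fun s _ => ?_
          simp_rw [Finset.sum_comm (s := Finset.range N) (t := Finset.range M)]
      _ = _ := by
          refine Finset.sum_congr rfl fun s _ => Finset.sum_congr rfl fun a _ =>
            Finset.sum_congr rfl fun b _ => ?_
          simp only [hU, hV]
          rw [Finset.sum_mul_sum, Finset.mul_sum]
          simp_rw [Finset.mul_sum]
  rw [hsum]
  -- For fixed `a`, distinct `k` give distinct `s`; Bessel's inequality then sums over `a`.
  have hUb : ∑ s ∈ S, ∑ a ∈ Finset.range M, ‖U s a‖ ^ 2 ≤ ∑ k ∈ Finset.range N, ‖y k‖ ^ 2 := by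
    rw [Finset.sum_comm]
    refine (Finset.sum_le_sum fun a _ => sum_norm_sq_sum_ite_le S (Finset.range N)
      (f := fun k : ℕ => (2 : ℤ) ^ a - k) (fun i _ j _ h => by simpa using h)
      fun k => α k a).trans ?_
    rw [Finset.sum_comm]
    refine Finset.sum_le_sum fun k _ => ?_
    simp only [hα, norm_inner_symm (y k)]
    exact he.sum_inner_products_le (y k)
  have hVb : ∑ s ∈ S, ∑ b ∈ Finset.range M, ‖V s b‖ ^ 2 ≤ ∑ m ∈ Finset.range N, ‖x m‖ ^ 2 := by
    rw [Finset.sum_comm]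
    refine (Finset.sum_le_sum fun b _ => sum_norm_sq_sum_ite_le S (Finset.range N)
      (f := fun m : ℕ => (m : ℤ) - 2 ^ b) (fun i _ j _ h => by simpa using h)
      fun m => β m b).trans ?_
    rw [Finset.sum_comm]
    exact Finset.sum_le_sum fun m _ => he.sum_inner_products_le (x m)
  calc _ ≤ ∑ s ∈ S, 2 * Real.pi * (√(∑ a ∈ Finset.range M, ‖U s a‖ ^ 2) *
        √(∑ b ∈ Finset.range M, ‖V s b‖ ^ 2)) :=
        (norm_sum_le _ _).trans (Finset.sum_le_sum fun s _ =>
          norm_sum_inv_sub_mul_le M (U s) (V s))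
    _ = 2 * Real.pi * ∑ s ∈ S, √(∑ a ∈ Finset.range M, ‖U s a‖ ^ 2) *
        √(∑ b ∈ Finset.range M, ‖V s b‖ ^ 2) := by rw [Finset.mul_sum]
    _ ≤ 2 * Real.pi * (√(∑ s ∈ S, ∑ a ∈ Finset.range M, ‖U s a‖ ^ 2) *
        √(∑ s ∈ S, ∑ b ∈ Finset.range M, ‖V s b‖ ^ 2)) := by
        gcongr
        exact Real.sum_sqrt_mul_sqrt_le _ (fun _ => Finset.sum_nonneg fun _ _ => by positivity)
          fun _ => Finset.sum_nonneg fun _ _ => by positivity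
    _ ≤ _ := by gcongr

end Counterexample
end VectorHankel

/-! ### The weighted form is unbounded. -/

namespace VectorHankel
open MeasureTheory Filter Topology

lemma exists_orthonormal_nat {H : Type*} [NormedAddCommGroup H] [InnerProductSpace ℂ H]
    [CompleteSpace H] (hH : ¬ FiniteDimensional ℂ H) : ∃ e : ℕ → H, Orthonormal ℂ e := by
  obtain ⟨w, b, -⟩ := exists_hilbertBasis ℂ H
  have hw : Infinite w := by
    by_contra h
    rw [not_infinite_iff_finite] at h
    have := Fintype.ofFinite w
    exact hH (Module.Finite.of_basis b.toOrthonormalBasis.toBasis)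
  exact ⟨b ∘ Infinite.natEmbedding w, b.orthonormal.comp _ (Infinite.natEmbedding w).injective⟩

/-- The weights `(k + 1) / (m + k + 2)` at `k = 2 ^ a`, `m = 2 ^ b` smoothly truncate a matrix to
its lower triangle, and so make the sum of the entries of Hilbert's matrix large. -/
lemma le_sum_truncated_inv_sub (n : ℕ) :
    (n : ℝ) * (∑ j ∈ Finset.range n, 1 / ((j : ℝ) + 1)) / 10 ≤
      ∑ a ∈ Finset.range (2 * n), ∑ b ∈ Finset.range (2 * n),
        ((2 : ℝ) ^ a + 1) / (2 ^ b + 2 ^ a + 2) * ((a : ℝ) - b)⁻¹ := by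
  set w : ℕ → ℕ → ℝ := fun a b => ((2 : ℝ) ^ a + 1) / (2 ^ b + 2 ^ a + 2) with hw
  set T := ∑ a ∈ Finset.range (2 * n), ∑ b ∈ Finset.range (2 * n), w a b * ((a : ℝ) - b)⁻¹
    with hT
  -- Antisymmetry of `(a - b)⁻¹` replaces the weight by its antisymmetric part, after which all
  -- terms are nonnegative.
  have hsymm : 2 * T = ∑ a ∈ Finset.range (2 * n), ∑ b ∈ Finset.range (2 * n),
      (w a b - w b a) * ((a : ℝ) - b)⁻¹ := by
    have h1 : T = ∑ a ∈ Finset.range (2 * n), ∑ b ∈ Finset.range (2 * n),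
        -(w b a * ((a : ℝ) - b)⁻¹) := by
      rw [hT, Finset.sum_comm]
      refine Finset.sum_congr rfl fun a _ => Finset.sum_congr rfl fun b _ => ?_
      rw [← neg_sub (a : ℝ) b, inv_neg]
      ring
    rw [two_mul]
    nth_rewrite 2 [h1]
    rw [hT, ← Finset.sum_add_distrib]
    refine Finset.sum_congr rfl fun a _ => ?_
    rw [← Finset.sum_add_distrib]
    exact Finset.sum_congr rfl fun b _ => by ring
  -- The difference of weights is `(2^a - 2^b)/(2^a + 2^b + 2)`, at least `1/5` when `b < a`, with
  -- equality at `a = 1`, `b = 0`.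
  have hlt : ∀ a b : ℕ, b < a → 1 / 5 * ((a : ℝ) - b)⁻¹ ≤ (w a b - w b a) * ((a : ℝ) - b)⁻¹ := by
    intro a b hab
    have hpos : 0 < (a : ℝ) - b := sub_pos.2 (by exact_mod_cast hab)
    gcongr
    have h1 : (2 : ℝ) * 2 ^ b ≤ 2 ^ a := by
      rw [← pow_succ']; exact pow_le_pow_right₀ one_le_two hab
    have h2 : (1 : ℝ) ≤ 2 ^ b := one_le_pow₀ one_le_two
    simp only [hw]
    rw [add_comm ((2 : ℝ) ^ a) (2 ^ b), ← sub_div, le_div_iff₀ (by positivity)]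
    linarith
  have hnn : ∀ a b : ℕ, 0 ≤ (w a b - w b a) * ((a : ℝ) - b)⁻¹ := by
    intro a b
    rcases lt_trichotomy a b with h | h | h
    · have h1 := hlt b a h
      have h2 : 0 < (b : ℝ) - a := sub_pos.2 (by exact_mod_cast h)
      rw [← neg_sub (b : ℝ) a, inv_neg, ← neg_sub (w b a), neg_mul_neg]
      exact le_trans (by positivity) h1
    · simp [h]
    · have h2 : 0 < (a : ℝ) - b := sub_pos.2 (by exact_mod_cast h)
      exact le_trans (by positivity) (hlt a b h)
  -- Each of the upper `n` rows has at least `n` entries with `b < a`, hence dominates a harmonic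
  -- sum of length `n`.
  have hrow : ∀ a ∈ Finset.range (2 * n), n ≤ a →
      1 / 5 * ∑ j ∈ Finset.range n, 1 / ((j : ℝ) + 1) ≤
        ∑ b ∈ Finset.range (2 * n), (w a b - w b a) * ((a : ℝ) - b)⁻¹ := by
    intro a ha hna
    rw [Finset.mem_range] at ha
    calc 1 / 5 * ∑ j ∈ Finset.range n, 1 / ((j : ℝ) + 1)
        ≤ 1 / 5 * ∑ j ∈ Finset.range a, 1 / ((j : ℝ) + 1) := by
          gcongr
      _ = 1 / 5 * ∑ b ∈ Finset.range a, ((a : ℝ) - b)⁻¹ := by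
          rw [← Finset.sum_range_reflect]
          congr 1
          refine Finset.sum_congr rfl fun b hb => ?_
          rw [Finset.mem_range] at hb
          rw [one_div]
          congr 1
          rw [Nat.sub_sub, Nat.cast_sub (by omega)]
          push_cast
          ring
      _ ≤ ∑ b ∈ Finset.range a, (w a b - w b a) * ((a : ℝ) - b)⁻¹ := by
          rw [Finset.mul_sum]
          exact Finset.sum_le_sum fun b hb => hlt a b (Finset.mem_range.1 hb)
      _ ≤ _ := Finset.sum_le_sum_of_subset_of_nonneg
          (Finset.range_subset_range.2 (by omega)) fun b _ _ => hnn a b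
  have h2 : (n : ℝ) * (1 / 5 * ∑ j ∈ Finset.range n, 1 / ((j : ℝ) + 1)) ≤ 2 * T := by
    rw [hsymm]
    calc (n : ℝ) * (1 / 5 * ∑ j ∈ Finset.range n, 1 / ((j : ℝ) + 1))
        = ∑ a ∈ Finset.Ico n (2 * n), 1 / 5 * ∑ j ∈ Finset.range n, 1 / ((j : ℝ) + 1) := by
          rw [Finset.sum_const, Nat.card_Ico, nsmul_eq_mul]
          congr 2
          omega
      _ ≤ ∑ a ∈ Finset.Ico n (2 * n),
            ∑ b ∈ Finset.range (2 * n), (w a b - w b a) * ((a : ℝ) - b)⁻¹ :=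
          Finset.sum_le_sum fun a ha => hrow a
            (Finset.mem_range.2 (Finset.mem_Ico.1 ha).2) (Finset.mem_Ico.1 ha).1
      _ ≤ _ := Finset.sum_le_sum_of_subset_of_nonneg
          (fun a ha => Finset.mem_range.2 (Finset.mem_Ico.1 ha).2)
          fun a _ _ => Finset.sum_nonneg fun b _ => hnn a b
  linarith

lemma inner_hilbertCoeff_orthonormal {H : Type*} [NormedAddCommGroup H] [InnerProductSpace ℂ H]
    {e : ℕ → H} (he : Orthonormal ℂ e) (a b : ℕ) :
    inner ℂ (e a) (hilbertCoeff e (2 ^ b + 2 ^ a) (e b)) = ((((a : ℝ) - b)⁻¹ : ℝ) : ℂ) := by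
  have ha := a.lt_two_pow_self
  have hb := b.lt_two_pow_self
  rw [inner_hilbertCoeff e le_rfl,
    Finset.sum_eq_single_of_mem a (Finset.mem_range.2 (by omega)),
    Finset.sum_eq_single_of_mem b (Finset.mem_range.2 (by omega))]
  · rw [if_pos (add_comm _ _)]
    simp [he.1]
  · intro b' _ hb'
    simp [orthonormal_iff_ite.1 he, hb']
  · intro a' _ ha'
    refine Finset.sum_eq_zero fun b' _ => ?_
    simp [orthonormal_iff_ite.1 he, Ne.symm ha']

/-- The form with coefficients `hilbertCoeff e` is unbounded with the weights
`(k + 1) / (m + k + 2)`. -/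
lemma not_hankelFormBound_hilbertCoeff {H : Type*} [NormedAddCommGroup H]
    [InnerProductSpace ℂ H] {e : ℕ → H} (he : Orthonormal ℂ e) {C : ℝ} (hC : 0 ≤ C) :
    ¬ HankelFormBound (fun k m => ((k : ℝ) + 1) / ((m : ℝ) + k + 2)) (hilbertCoeff e) C := by
  intro h
  -- The test sequence below has squared norm at most `2n`; with the factor `1/10` of
  -- `le_sum_truncated_inv_sub` this gives `20 C`.
  have key : ∀ n : ℕ, 0 < n → ∑ j ∈ Finset.range n, 1 / ((j : ℝ) + 1) ≤ 20 * C := by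
    intro n hn
    set K := 2 ^ (2 * n) with hK
    -- Lacunary test sequence, `e a` in position `2^a`: it compresses the weighted form to the
    -- truncated Hilbert matrix.
    set x : ℕ → H := fun k => ∑ a ∈ Finset.range (2 * n), if 2 ^ a = k then e a else 0 with hx
    have hxs : ∑ k ∈ Finset.range K, ‖x k‖ ^ 2 ≤ 2 * n := by
      refine (sum_norm_sq_sum_ite_le _ (Finset.range (2 * n)) (f := fun a => 2 ^ a)
        (Nat.pow_right_injective le_rfl).injOn e).trans (le_of_eq ?_)
      simp [he.1]
    have hform : ∑ k ∈ Finset.range K, ∑ m ∈ Finset.range K,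
        ((((k : ℝ) + 1) / ((m : ℝ) + k + 2) : ℝ) : ℂ) *
          inner ℂ (x k) (hilbertCoeff e (m + k) (x m)) =
        ((∑ a ∈ Finset.range (2 * n), ∑ b ∈ Finset.range (2 * n),
          ((2 : ℝ) ^ a + 1) / (2 ^ b + 2 ^ a + 2) * ((a : ℝ) - b)⁻¹ : ℝ) : ℂ) := by
      calc _ = ∑ k ∈ Finset.range K, ∑ m ∈ Finset.range K, ∑ a ∈ Finset.range (2 * n),
            ∑ b ∈ Finset.range (2 * n), if 2 ^ b = m then (if 2 ^ a = k then
              ((((k : ℝ) + 1) / ((m : ℝ) + k + 2) : ℝ) : ℂ) *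
                inner ℂ (e a) (hilbertCoeff e (m + k) (e b)) else 0) else 0 := by
            refine Finset.sum_congr rfl fun k _ => Finset.sum_congr rfl fun m _ => ?_
            simp only [hx, map_sum, sum_inner, inner_sum, Finset.mul_sum]
            rw [Finset.sum_comm]
            refine Finset.sum_congr rfl fun a _ => Finset.sum_congr rfl fun b _ => ?_
            split_ifs <;> simp
        _ = ∑ a ∈ Finset.range (2 * n), ∑ b ∈ Finset.range (2 * n), ∑ k ∈ Finset.range K,
            ∑ m ∈ Finset.range K, if 2 ^ b = m then (if 2 ^ a = k then
              ((((k : ℝ) + 1) / ((m : ℝ) + k + 2) : ℝ) : ℂ) *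
                inner ℂ (e a) (hilbertCoeff e (m + k) (e b)) else 0) else 0 := by
            simp_rw [Finset.sum_comm (s := Finset.range K) (t := Finset.range (2 * n))]
        _ = _ := by
            push_cast
            refine Finset.sum_congr rfl fun a ha => Finset.sum_congr rfl fun b hb => ?_
            have hmem : ∀ c ∈ Finset.range (2 * n), 2 ^ c ∈ Finset.range K := fun c hc =>
              Finset.mem_range.2 (Nat.pow_lt_pow_right one_lt_two (Finset.mem_range.1 hc))
            simp_rw [Finset.sum_ite_eq, if_pos (hmem b hb), Finset.sum_ite_eq, if_pos (hmem a ha)]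
            rw [inner_hilbertCoeff_orthonormal he]
            push_cast
            rfl
    have h1 := h K x x
    rw [hform] at h1
    have h2 := le_sum_truncated_inv_sub n
    have hn0 : (0 : ℝ) < n := by exact_mod_cast hn
    have h3 := (h2.trans (le_abs_self _)).trans ((Complex.norm_real _).symm.le.trans h1)
    rw [Real.mul_self_sqrt (Finset.sum_nonneg fun _ _ => by positivity)] at h3
    have h4 := h3.trans (mul_le_mul_of_nonneg_left hxs hC)
    have h5 : (n : ℝ) * ∑ j ∈ Finset.range n, 1 / ((j : ℝ) + 1) ≤ n * (20 * C) := by linarith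
    exact le_of_mul_le_mul_left h5 hn0
  have ht := Real.tendsto_sum_range_one_div_nat_succ_atTop
  obtain ⟨n, hn1, hn2⟩ := ((ht.eventually_gt_atTop (20 * C)).and (eventually_gt_atTop 0)).exists
  exact absurd (key n hn2) (not_le.2 hn1)

/-- On an infinite-dimensional space there is a bounded Hankel operator whose symbol fails the
anti-analytic Carleson embedding condition. -/
theorem exists_normNP_lt_top_normC_eq_top {H : Type*} [NormedAddCommGroup H]
    [InnerProductSpace ℂ H] [CompleteSpace H] (hH : ¬ FiniteDimensional ℂ H) :
    ∃ φ : ℂ → (H →L[ℂ] H), IsHol φ ∧ normNP φ < ∞ ∧ normC φ = ∞ := by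
  obtain ⟨e, he⟩ := exists_orthonormal_nat hH
  have hs : ∀ r ∈ Set.Ioo (0 : ℝ) 1, Summable fun n => ‖hilbertCoeff e n‖ * r ^ n :=
    fun r hr => summable_norm_hilbertCoeff he hr
  set φ : ℂ → (H →L[ℂ] H) := fun z => ∑' n, z ^ n • hilbertCoeff e n with hφ
  have hsum : ∀ z : ℂ, ‖z‖ < 1 → HasSum (fun n => z ^ n • hilbertCoeff e n) (φ z) := by
    intro z hz
    obtain ⟨r, hzr, hr1⟩ := exists_between hz
    refine (Summable.of_norm_bounded (hs r ⟨(norm_nonneg z).trans_lt hzr, hr1⟩) fun n => ?_).hasSum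
    rw [norm_smul, norm_pow, mul_comm]
    gcongr
  have hhol : IsHol φ := isHol_of_hasSum hs hsum
  have hcoeff : taylorCoeff φ = hilbertCoeff e := funext (taylorCoeff_eq_of_hasSum hs hsum)
  refine ⟨φ, hhol, ?_, ?_⟩
  · refine (normNP_le_of_hankelFormBound hhol (C := 2 * Real.pi) (by positivity) ?_).trans_lt
      ENNReal.ofReal_lt_top
    rw [hcoeff]
    exact hankelFormBound_hilbertCoeff he
  · by_contra hne
    have h := hankelFormBound_of_normC hhol (lt_top_iff_ne_top.2 hne)
    rw [hcoeff] at h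
    exact not_hankelFormBound_hilbertCoeff he ENNReal.toReal_nonneg h

end VectorHankel

theorem mainTheorem3 :
    ∃ C : ℝ≥0, 0 < C ∧
      ∀ (H : Type*) [NormedAddCommGroup H] [InnerProductSpace ℂ H] [CompleteSpace H]
        [TopologicalSpace.SeparableSpace H],
        (∀ φ : ℂ → (H →L[ℂ] H), VectorHankel.IsHol φ →
          VectorHankel.normC φ < ∞ → VectorHankel.normC (VectorHankel.sharp φ) < ∞ →
            VectorHankel.normNP φ < ∞ ∧
            VectorHankel.normNP φ ≤
              C * (VectorHankel.normC φ + VectorHankel.normC (VectorHankel.sharp φ))) ∧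
        (¬ FiniteDimensional ℂ H →
          (∃ φ : ℂ → (H →L[ℂ] H), VectorHankel.IsHol φ ∧ VectorHankel.normNP φ < ∞ ∧
            ¬ (VectorHankel.normC φ < ∞ ∧ VectorHankel.normC (VectorHankel.sharp φ) < ∞)) ∧
          VectorHankel.BMOAC H ∩ VectorHankel.BMOACSharp H ⊂ VectorHankel.BMOANP H) := by
  refine ⟨1, one_pos, fun H _ _ _ _ => ⟨fun φ hφ hC hC' => ?_, fun hH => ?_⟩⟩
  · have h := VectorHankel.normNP_le hφ hC hC'
    exact ⟨h.trans_lt (ENNReal.add_lt_top.2 ⟨hC, hC'⟩), by simpa using h⟩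
  · obtain ⟨φ, hφ, hNP, hC⟩ := VectorHankel.exists_normNP_lt_top_normC_eq_top hH
    refine ⟨⟨φ, hφ, hNP, fun h => h.1.ne hC⟩, ?_⟩
    rw [Set.ssubset_iff_exists]
    refine ⟨fun ψ hψ => ⟨hψ.1.1, ?_⟩, φ, ⟨hφ, hNP⟩, fun h => h.1.2.ne hC⟩
    exact (VectorHankel.normNP_le hψ.1.1 hψ.1.2 hψ.2.2.2).trans_lt
      (ENNReal.add_lt_top.2 ⟨hψ.1.2, hψ.2.2.2⟩)
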